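/- **Setting.** Let $\mathcal G$ be an undirected graph without self-loops on the finite set $\mathcal V$ of agents, with weights $a_{ij}=a_{ji}$, $a_{ij}>0$ if $j\in\mathcal N_i$ (that is, $j$ is a neighbour of $i$) and $a_{ij}=0$ otherwise, and with Laplacian $\mathcal L=[l_{ij}]$, $l_{ii}=\sum_k a_{ik}$, $l_{ij}=-a_{ij}$ for $i\ne j$. Consider $\dot x=Ax$ with $A\in\mathbb R^{n\times n}$ and measurements $y_i=H_ix$, $H_i\in\mathbb R^{m_i\times n}$, and let $H$ be the matrix obtained by stacking all $H_i$. For a matrix $C$ with $n$ columns, the undetectable subspace of $(A,C)$ is $\bigcap_{k=1}^n\ker(CA^{k-1})\cap\ker\mathcal F_A^+(A)$, where $\mathcal F_A^+$ is the factor of the characteristic polynomial of $A$ that collects its roots in the closed right half-plane; $(A,C)$ is detectable if this subspace is $\{0\}$. Norms are Euclidean norms and induced matrix 2-norms. **Design.** Let $\mathcal U_i$ be the undetectable subspace of $(A,H_i)$ and $p_i=\dim\mathcal U_i$. Let the columns of $D_i$ and $U_i$ be orthonormal bases of $\mathcal U_i^\perp$ and $\mathcal U_i$, let $T_i=[D_i\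 U_i]$, and write $$T_i^{\mathrm T}AT_i=\begin{bmatrix}A_{i\mathrm d}&0\\A_{i\mathrm r}&A_{i\mathrm u}\end{bmatrix},\qquad H_iT_i=\begin{bmatrix}H_{i\mathrm d}&0\end{bmatrix}.$$ Choose any $L_{i\mathrm d}$ such that $A_{i\mathrm d}-L_{i\mathrm d}H_{i\mathrm d}$ is Hurwitz, and put $$L_i=T_i\begin{bmatrix}L_{i\mathrm d}\\0\end{bmatrix},\qquad M_i=T_i\begin{bmatrix}0&0\\0&I_{p_i}\end{bmatrix}T_i^{\mathrm T}.$$ With $U=\mathrm{diag}\{U_i\}$ and $A_{\mathrm u}=\mathrm{diag}\{A_{i\mathrm u}\}$, choose any constant $$c\ \ge\ \frac{2(2+\|A_{\mathrm u}+A_{\mathrm u}^{\mathrm T}\|)}{\lambda_{\min}(U^{\mathrm T}(\mathcal L\otimes I_n)U)}$$ (if all $p_i=0$, the right-hand side is read as $0$). Choose any $0<\beta<1$ and any $\kappa_i,\delta_i,\gamma_i,\bar\tau_i>0$. **Closed loop.** Agent $i$ samples at instants $0=t_0^i<t_1^i<\cdots$, and $\bar x_i(t)=e^{A(t-t_k^i)}\hat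 x_i(t_k^i)$ for $t\in[t_k^i,t_{k+1}^i)$. Let $\tilde x_i=\bar x_i-\hat x_i$ and $\tilde x_{i\mathrm u}=U_i^{\mathrm T}\tilde x_i$. The estimates $\hat x_i$ and the auxiliary variables $\rho_i$, with $\rho_i(0)>0$, are continuous and satisfy $$\dot{\hat x}_i=A\hat x_i+L_i(y_i-H_i\hat x_i)-cM_i\sum_{j\in\mathcal N_i}a_{ij}(\bar x_i-\bar x_j),$$ $$\dot\rho_i=-\delta_i\rho_i-4l_{ii}\|\tilde x_{i\mathrm u}\|^2+\beta\sum_{j\in\mathcal N_i}a_{ij}\|\bar x_i-\bar x_j\|^2+\gamma_i\|H_i\hat x_i-y_i\|^2$$ (derivatives from the right at sampling instants), and the sampling instants are generated by $$t_{k+1}^i=\inf\{t>t_k^i: f_i(t)\ge0\ \text{ or }\ t-t_k^i\ge\bar\tau_i\},$$ $$f_i=4l_{ii}\|\tilde x_{i\mathrm u}\|^2-\beta\sum_{j\in\mathcal N_i}a_{ij}\|\bar x_i-\bar x_j\|^2-\kappa_i\rho_i,$$ where $f_i$ is evaluated with the prediction $\bar x_i$ started from the sample at $t_k^i$; at an instant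 at which a neighbour $j$ itself samples, $f_i$ may use the value of $\bar x_j$ just before or just after that sample. A solution is required to satisfy these equations up to the first time at which the sampling instants of some agent accumulate (for all $t\ge0$ if there is no such time). **Theorem.** Suppose that $\mathcal G$ is connected and $(A,H)$ is detectable. Then there are constants $\xi>0$ and $C>0$, depending only on the system, the network and the design choices above, such that for every solution of the closed loop, with arbitrary initial values $x(0)$, $\hat x_i(0)$ and $\rho_i(0)>0$, the sampling instants of no agent accumulate ($t_k^i\to\infty$ as $k\to\infty$ for every $i$), so that the solution is defined for all $t\ge0$, and the estimation errors $\eta_i=\hat x_i-x$ converge to zero exponentially: $$\|\eta_i(t)\|\ \le\ C\Big(\sum_{j\in\mathcal V}\big(\|\eta_j(0)\|^2+\rho_j(0)\big)\Big)^{1/2}e^{-\xi t}\qquad\text{for all }i\in\mathcal V,\ t\ge0.$$ -/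

import Mathlib

noncomputable section

namespace DistributedObserver

open Matrix

/-- The state space with its Euclidean norm. -/
abbrev E (n : ℕ) : Type := EuclideanSpace ℝ (Fin n)

/-- The factor of the characteristic polynomial of `A` that collects, with multiplicity, the roots
in the closed right half-plane (its coefficients are real, but it is written over `ℂ`). -/
def closedRightFactor {n : ℕ} (A : Matrix (Fin n) (Fin n) ℝ) : Polynomial ℂ :=
  ((((A.map Complex.ofReal).charpoly.roots).filter (fun z => 0 ≤ z.re)).map
    (fun z => Polynomial.X - Polynomial.C z)).prod

/-- The real kernel of the matrix obtained by evaluating `closedRightFactor A` at `A`. -/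
def closedRightKernel {n : ℕ} (A : Matrix (Fin n) (Fin n) ℝ) : Submodule ℝ (E n) where
  carrier := {v | (Polynomial.aeval (A.map Complex.ofReal) (closedRightFactor A)) *ᵥ
    (fun r => (v r : ℂ)) = 0}
  zero_mem' := by
    have h : (fun r : Fin n => (((0 : E n) r : ℝ) : ℂ)) = 0 := by ext r; simp
    simp only [Set.mem_ofPred_eq, h, mulVec_zero]
  add_mem' := by
    intro v w hv hw
    have h : (fun r : Fin n => (((v + w) r : ℝ) : ℂ))
        = (fun r => (v r : ℂ)) + (fun r => (w r : ℂ)) := by ext r; simp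
    simp only [Set.mem_ofPred_eq] at hv hw ⊢
    rw [h, mulVec_add, hv, hw, add_zero]
  smul_mem' := by
    intro c v hv
    have h : (fun r : Fin n => (((c • v) r : ℝ) : ℂ)) = (c : ℂ) • (fun r => (v r : ℂ)) := by
      ext r; simp
    simp only [Set.mem_ofPred_eq] at hv ⊢
    rw [h, mulVec_smul, hv, smul_zero]

/-- The undetectable subspace of the pair `(A, H)`. -/
def undetectableSubspace {n : ℕ} {r : Type*} [Fintype r] (A : Matrix (Fin n) (Fin n) ℝ)
    (H : Matrix r (Fin n) ℝ) : Submodule ℝ (E n) :=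
  (⨅ k : Fin n, LinearMap.ker (toEuclideanLin (H * A ^ (k : ℕ)))) ⊓ closedRightKernel A

/-- Detectability of the pair `(A, H)`. -/
def Detectable {n : ℕ} {r : Type*} [Fintype r] (A : Matrix (Fin n) (Fin n) ℝ)
    (H : Matrix r (Fin n) ℝ) : Prop :=
  undetectableSubspace A H = ⊥

/-- A real square matrix is Hurwitz if all its complex eigenvalues have negative real part. -/
def IsHurwitz {q : Type*} [Fintype q] [DecidableEq q] (X : Matrix q q ℝ) : Prop :=
  ∀ z ∈ spectrum ℂ (X.map Complex.ofReal), z.re < 0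

/-- The induced matrix 2-norm. -/
def norm2 {q : Type*} [Fintype q] [DecidableEq q] (X : Matrix q q ℝ) : ℝ :=
  ‖Matrix.toEuclideanCLM (𝕜 := ℝ) X‖

/-- The smallest eigenvalue of a real symmetric matrix. -/
def lambdaMin {q : Type*} [Fintype q] [DecidableEq q] (X : Matrix q q ℝ) : ℝ :=
  sInf (spectrum ℝ X)

/-- An undirected graph without self-loops together with its adjacency matrix. -/
structure WeightedGraph (ι : Type*) where
  graph : SimpleGraph ι
  a : Matrix ι ι ℝ
  a_symm : ∀ i j, a i j = a j i
  a_pos : ∀ i j, graph.Adj i j → 0 < a i j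
  a_zero : ∀ i j, ¬ graph.Adj i j → a i j = 0

/-- The Laplacian matrix. -/
def WeightedGraph.laplacian {ι : Type*} [Fintype ι] [DecidableEq ι] (G : WeightedGraph ι) :
    Matrix ι ι ℝ :=
  Matrix.of fun i j => if i = j then ∑ k, G.a i k else - G.a i j

/-- The plant, the measurements, the communication network and all free choices made in the
design of the observer and of the triggering mechanism. Agent `i` measures `m i` numbers. The
undetectable subspace of agent `i` has dimension `p i`, its orthogonal complement has dimension
`q i`, and `basisU i`, `basisD i` are arbitrary orthonormal bases of them. -/
structure Design (ι : Type*) [Fintype ι] (n : ℕ) (m : ι → ℕ) where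
  A : Matrix (Fin n) (Fin n) ℝ
  H : (i : ι) → Matrix (Fin (m i)) (Fin n) ℝ
  net : WeightedGraph ι
  q : ι → ℕ
  p : ι → ℕ
  basisD : (i : ι) → OrthonormalBasis (Fin (q i)) ℝ (undetectableSubspace A (H i))ᗮ
  basisU : (i : ι) → OrthonormalBasis (Fin (p i)) ℝ (undetectableSubspace A (H i))
  Ld : (i : ι) → Matrix (Fin (q i)) (Fin (m i)) ℝ
  c : ℝ
  β : ℝ
  κ : ι → ℝ
  δ : ι → ℝ
  γ : ι → ℝ
  τ : ι → ℝ

namespace Design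

variable {ι : Type*} [Fintype ι] [DecidableEq ι] {n : ℕ} {m : ι → ℕ} (S : Design ι n m)

/-- The stacked output matrix of the whole network. -/
def stackedH : Matrix (Σ i, Fin (m i)) (Fin n) ℝ := Matrix.of fun r s => S.H r.1 r.2 s

/-- The matrix whose columns are the chosen orthonormal basis of the orthogonal complement of the
undetectable subspace. -/
def D (i : ι) : Matrix (Fin n) (Fin (S.q i)) ℝ := Matrix.of fun r s => (S.basisD i s : E n) r

/-- The matrix whose columns are the chosen orthonormal basis of the undetectable subspace. -/
def U (i : ι) : Matrix (Fin n) (Fin (S.p i)) ℝ := Matrix.of fun r s => (S.basisU i s : E n) r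

/-- The orthonormal change of basis `[D U]`. -/
def T (i : ι) : Matrix (Fin n) (Fin (S.q i) ⊕ Fin (S.p i)) ℝ := fromCols (S.D i) (S.U i)

/-- The detectable diagonal block of `Tᵀ A T`. -/
def Ad (i : ι) : Matrix (Fin (S.q i)) (Fin (S.q i)) ℝ := ((S.T i)ᵀ * S.A * S.T i).toBlocks₁₁

/-- The undetectable diagonal block of `Tᵀ A T`. -/
def Au (i : ι) : Matrix (Fin (S.p i)) (Fin (S.p i)) ℝ := ((S.T i)ᵀ * S.A * S.T i).toBlocks₂₂

/-- The detectable block of `H T`. -/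
def Hd (i : ι) : Matrix (Fin (m i)) (Fin (S.q i)) ℝ := (S.H i * S.T i).toCols₁

/-- The output injection gain. -/
def L (i : ι) : Matrix (Fin n) (Fin (m i)) ℝ := S.T i * fromRows (S.Ld i) 0

/-- The consensus gain. -/
def M (i : ι) : Matrix (Fin n) (Fin n) ℝ :=
  S.T i * (fromBlocks 0 0 0 1 : Matrix (Fin (S.q i) ⊕ Fin (S.p i)) (Fin (S.q i) ⊕ Fin (S.p i)) ℝ)
    * (S.T i)ᵀ

/-- The block-diagonal matrix with diagonal blocks `Au i`. -/
def AuAll : Matrix (Σ i, Fin (S.p i)) (Σ i, Fin (S.p i)) ℝ := blockDiagonal' S.Au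

/-- The block-diagonal matrix with diagonal blocks `U i`. -/
def UAll : Matrix (Σ _ : ι, Fin n) (Σ i, Fin (S.p i)) ℝ := blockDiagonal' S.U

/-- The Kronecker product of the Laplacian with the identity. -/
def laplacianKron : Matrix (Σ _ : ι, Fin n) (Σ _ : ι, Fin n) ℝ :=
  (kroneckerMap (· * ·) S.net.laplacian (1 : Matrix (Fin n) (Fin n) ℝ)).submatrix
    (Equiv.sigmaEquivProd ι (Fin n)) (Equiv.sigmaEquivProd ι (Fin n))

/-- The requirements on the free choices. If every undetectable subspace is zero, then `lambdaMin`
is taken of the empty matrix, the quotient is zero in Lean, and the bound on `c` reads `0 ≤ c`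
(while `c` has no influence on the observer, because all `M i` vanish). -/
structure Admissible : Prop where
  hurwitz : ∀ i, IsHurwitz (S.Ad i - S.Ld i * S.Hd i)
  c_bound : 2 * (2 + norm2 (S.AuAll + S.AuAllᵀ)) /
    lambdaMin (S.UAllᵀ * S.laplacianKron * S.UAll) ≤ S.c
  β_pos : 0 < S.β
  β_lt_one : S.β < 1
  κ_pos : ∀ i, 0 < S.κ i
  δ_pos : ∀ i, 0 < S.δ i
  γ_pos : ∀ i, 0 < S.γ i
  τ_pos : ∀ i, 0 < S.τ i

/-- The prediction at time `t` obtained from the sample of the signal `z` taken at time `s`. -/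
def hold (z : ℝ → E n) (s t : ℝ) : E n := toEuclideanLin (NormedSpace.exp ((t - s) • S.A)) (z s)

/-- `4 lᵢᵢ ‖v_u‖²`, where `v_u = Uᵢᵀ v` is the undetectable part of the vector `v`. -/
def sampleErr (i : ι) (v : E n) : ℝ :=
  4 * S.net.laplacian i i * ‖toEuclideanLin (S.U i)ᵀ v‖ ^ 2

/-- The weighted disagreement of a vector `z` with the values `w j` of the neighbours of `i`
(the weights of all other agents are zero). -/
def disagreement (i : ι) (z : E n) (w : ι → E n) : ℝ := ∑ j, S.net.a i j * ‖z - w j‖ ^ 2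

/-- The triggering function of agent `i`, as a function of its own prediction `z`, its estimate
`xh`, the predictions `w j` of the neighbours and the auxiliary variable `r`. -/
def triggerFun (i : ι) (z xh : E n) (w : ι → E n) (r : ℝ) : ℝ :=
  S.sampleErr i (z - xh) - S.β * S.disagreement i z w - S.κ i * r

/-- The right-hand side of the observer of agent `i`. -/
def observerRhs (i : ι) (x xh : E n) (xb : ι → E n) : E n :=
  toEuclideanLin S.A xh
    + toEuclideanLin (S.L i) (toEuclideanLin (S.H i) x - toEuclideanLin (S.H i) xh)
    - S.c • toEuclideanLin (S.M i) (∑ j, S.net.a i j • (xb i - xb j))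

/-- The right-hand side of the equation for the auxiliary variable of agent `i`. -/
def auxRhs (i : ι) (x xh : E n) (xb : ι → E n) (r : ℝ) : ℝ :=
  - S.δ i * r - S.sampleErr i (xb i - xh) + S.β * S.disagreement i (xb i) xb
    + S.γ i * ‖toEuclideanLin (S.H i) xh - toEuclideanLin (S.H i) x‖ ^ 2

end Design

/-- The sampling sequences of all agents go beyond the time `t ≥ 0`. The times with this property
form an interval `[0, T)`, and `T < ∞` exactly if the samples of some agent accumulate. -/
def Reached {ι : Type*} (ts : ι → ℕ → ℝ) (t : ℝ) : Prop := 0 ≤ t ∧ ∀ i, ∃ k, t < ts i k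

/-- A solution of the closed loop: state `x`, estimates `xh i`, predictions `xb i` from the
samples, auxiliary variables `ρ i` and sampling instants `ts i k`. Accumulation of the sampling
instants is not excluded: the equations are imposed at the times that are `Reached`, and the
signals are arbitrary afterwards.

Since the right-hand sides jump at sampling instants, the differential equations are imposed on
continuous functions through the derivative from the right.

While waiting for its sample `k + 1`, agent `i` evaluates its triggering function with the
prediction from its sample `k`. The signal `w i j` is the prediction of agent `j` used there; it
is the one of the current sampling interval of agent `j`, and at an instant at which agent `j`
itself takes a sample, it may be the value just before or just after that sample. -/
structure IsSolution {ι : Type*} [Fintype ι] [DecidableEq ι] {n : ℕ} {m : ι → ℕ}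
    (S : Design ι n m) (x : ℝ → E n) (xh xb : ι → ℝ → E n) (ρ : ι → ℝ → ℝ)
    (ts : ι → ℕ → ℝ) (w : ι → ι → ℝ → E n) : Prop where
  plant : ∀ t, 0 ≤ t → HasDerivWithinAt x (toEuclideanLin S.A (x t)) (Set.Ici 0) t
  ts_zero : ∀ i, ts i 0 = 0
  ts_strictMono : ∀ i, StrictMono (ts i)
  prediction : ∀ i k t, ts i k ≤ t → t < ts i (k + 1) → xb i t = S.hold (xh i) (ts i k) t
  xh_cont : ∀ i, ContinuousOn (xh i) {t | Reached ts t}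
  xh_deriv : ∀ i t, Reached ts t →
    HasDerivWithinAt (xh i) (S.observerRhs i (x t) (xh i t) (fun j => xb j t)) (Set.Ici t) t
  ρ_init : ∀ i, 0 < ρ i 0
  ρ_cont : ∀ i, ContinuousOn (ρ i) {t | Reached ts t}
  ρ_deriv : ∀ i t, Reached ts t →
    HasDerivWithinAt (ρ i) (S.auxRhs i (x t) (xh i t) (fun j => xb j t) (ρ i t)) (Set.Ici t) t
  neighbour : ∀ i j t, Reached ts t →
    ∃ k, ts j k ≤ t ∧ t ≤ ts j (k + 1) ∧ w i j t = S.hold (xh j) (ts j k) t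
  trigger : ∀ i k, ts i (k + 1) = sInf {t | ts i k < t ∧
    (0 ≤ S.triggerFun i (S.hold (xh i) (ts i k) t) (xh i t) (fun j => w i j t) (ρ i t) ∨
      S.τ i ≤ t - ts i k)}

end DistributedObserver

end

/-!
Let `η i = xh i - x` be the estimation errors and `e i = xb i - x` the errors of the predictions, and
split every vector into its undetectable coordinates `Uᵀ v` (`uc`) and its detectable coordinates
`Dᵀ v` (`dc`) for agent `i`. Since the undetectable subspace is invariant under `A` and is
annihilated by `H i`, the detectable coordinates of `η i` solve an autonomous Hurwitz system and
decay exponentially, whatever the network does (`dc_err_eq`, `IsHurwitz.exists_flow_le`). The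
detectable coordinates of `e i` decay as well, because the prediction follows the plant flow from a
sample that is at most `τ i` old (`exists_dc_decay`).

For the undetectable coordinates take `V = ∑ ‖Uᵀ η i‖² + (c / 2) ∑ ρ i`. Completing squares in the
consensus term (`neg_two_inner_le`, `neg_two_coupling_le`) leaves the sampling errors with a
positive and the disagreements of the predictions with a negative sign, and the equations of the
`ρ i` cancel both. Joint detectability and connectedness make the Laplacian positive definite on the
product of the undetectable subspaces (`posDef_laplacian`), so the bound on `c` makes the
consensus term dominate the growth due to `A` (`exists_coercive`). Altogether
`V' ≤ -∑ ‖Uᵀ η i‖² - (c / 2) ∑ δ i ρ i + (decaying terms)` (`exists_lyapunov_bound`). The triggering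
rule enters only through the positivity of `ρ i` (`ρ_lower`), which makes `V` control the
undetectable coordinates and turns this inequality into exponential decay (`exists_exp_decay`).

The estimate holds up to the first time `T` at which sampling instants accumulate. If `T` were
finite, the estimates would be bounded and hence Lipschitz continuous on `[0, T)`, so the sampling
errors at the ends of the shrinking sampling intervals would tend to zero. But at the end of an
interval that is not of maximal length the weighted squared sampling error is at least `κ i ρ i`,
which is bounded away from zero on `[0, T)` (`tendsto_ts`).
-/

noncomputable section

namespace DistributedObserver

open Matrix

/-! ### Linear differential equations with constant coefficients -/

section Decay

variable {F : Type*} [NormedAddCommGroup F] [NormedSpace ℂ F] [CompleteSpace F]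

lemma hasDerivAt_exp_smul_apply (N : F →L[ℂ] F) (v : F) (t : ℝ) :
    HasDerivAt (fun s : ℝ => NormedSpace.exp ((s : ℂ) • N) v)
      (NormedSpace.exp ((t : ℂ) • N) (N v)) t := by
  have h := (hasDerivAt_exp_smul_const (𝕂 := ℂ) N (t : ℂ)).scomp t Complex.ofRealCLM.hasDerivAt
  have h' := ((ContinuousLinearMap.apply ℂ F v).restrictScalars ℝ).hasFDerivAt.comp_hasDerivAt t h
  refine h'.congr_deriv ?_
  change ((1 : ℝ) : ℂ) • (_ : F) = _
  rw [Complex.ofReal_one, one_smul]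
  rfl

lemma hasDerivAt_exp_smul_apply' (N : F →L[ℂ] F) (v : F) (t : ℝ) :
    HasDerivAt (fun s : ℝ => NormedSpace.exp ((s : ℂ) • N) v)
      (N (NormedSpace.exp ((t : ℂ) • N) v)) t := by
  have h := (hasDerivAt_exp_smul_const' (𝕂 := ℂ) N (t : ℂ)).scomp t Complex.ofRealCLM.hasDerivAt
  have h' := ((ContinuousLinearMap.apply ℂ F v).restrictScalars ℝ).hasFDerivAt.comp_hasDerivAt t h
  refine h'.congr_deriv ?_
  change ((1 : ℝ) : ℂ) • (_ : F) = _
  rw [Complex.ofReal_one, one_smul]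
  rfl

/-- On a generalized eigenvector of eigenvalue zero, the flow of `N` grows at most
polynomially. -/
lemma exists_norm_exp_smul_le_pow (N : F →L[ℂ] F) (k : ℕ) :
    ∀ v : F, (N ^ k) v = 0 →
      ∃ K, 0 ≤ K ∧ ∀ t : ℝ, 0 ≤ t → ‖NormedSpace.exp ((t : ℂ) • N) v‖ ≤ K * (1 + t) ^ k := by
  induction k with
  | zero =>
    intro v hv
    refine ⟨0, le_rfl, fun t _ => ?_⟩
    have : v = 0 := by simpa using hv
    simp [this]
  | succ k ih =>
    intro v hv
    obtain ⟨K, hK, h⟩ := ih (N v) (by rw [pow_succ] at hv; exact hv)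
    refine ⟨‖v‖ + K, by positivity, fun t ht => ?_⟩
    have h1 : ‖NormedSpace.exp ((t : ℂ) • N) v - NormedSpace.exp (((0 : ℝ) : ℂ) • N) v‖
        ≤ K * (1 + t) ^ k * (t - 0) := by
      refine norm_image_sub_le_of_norm_deriv_right_le_segment
        (f := fun s : ℝ => NormedSpace.exp ((s : ℂ) • N) v) (a := 0) (b := t)
        (fun s _ => (hasDerivAt_exp_smul_apply N v s).continuousAt.continuousWithinAt)
        (fun s _ => (hasDerivAt_exp_smul_apply N v s).hasDerivWithinAt)
        (fun s hs => ?_) t ⟨ht, le_rfl⟩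
      refine (h s hs.1).trans ?_
      have := hs.1
      have := hs.2
      gcongr
    simp only [Complex.ofReal_zero, zero_smul, NormedSpace.exp_zero,
      one_apply_eq_self, sub_zero] at h1
    have h2 : ‖NormedSpace.exp ((t : ℂ) • N) v‖ ≤ K * (1 + t) ^ k * t + ‖v‖ := by
      have := norm_sub_norm_le (NormedSpace.exp ((t : ℂ) • N) v) v
      linarith
    have h3 : ‖v‖ ≤ ‖v‖ * (1 + t) ^ (k + 1) :=
      le_mul_of_one_le_right (norm_nonneg _) (one_le_pow₀ (by linarith))
    have h4 : K * (1 + t) ^ k * t ≤ K * (1 + t) ^ k * (1 + t) := by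
      gcongr; linarith
    calc _ ≤ _ := h2
      _ ≤ K * (1 + t) ^ k * (1 + t) + ‖v‖ * (1 + t) ^ (k + 1) := add_le_add h4 h3
      _ = _ := by ring

lemma exists_norm_exp_smul_le_exp (B : F →L[ℂ] F) (z : ℂ) {μ : ℝ} (hz : z.re < -μ) (k : ℕ)
    (v : F) (hv : ((B - z • 1) ^ k) v = 0) :
    ∃ K, 0 ≤ K ∧ ∀ t : ℝ, 0 ≤ t →
      ‖NormedSpace.exp ((t : ℂ) • B) v‖ ≤ K * Real.exp (-μ * t) := by
  obtain ⟨K, hK, h⟩ := exists_norm_exp_smul_le_pow (B - z • 1) k v hv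
  set ε := -μ - z.re with hε
  have hεp : 0 < ε := by linarith
  refine ⟨K * (k.factorial * Real.exp ε * (ε ^ k)⁻¹), by positivity, fun t ht => ?_⟩
  have hsplit : NormedSpace.exp ((t : ℂ) • B) v
      = Complex.exp (t * z) • NormedSpace.exp ((t : ℂ) • (B - z • 1)) v := by
    have h1 : (t : ℂ) • B = ((t : ℂ) * z) • (1 : F →L[ℂ] F) + (t : ℂ) • (B - z • 1) := by
      rw [smul_sub, smul_smul]; abel
    let _ : NormedAlgebra ℚ (F →L[ℂ] F) := .restrictScalars ℚ ℂ _
    rw [h1, NormedSpace.exp_add_of_commute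
      (((Commute.one_left _).smul_left _))]
    have h2 : NormedSpace.exp (((t : ℂ) * z) • (1 : F →L[ℂ] F))
        = Complex.exp (t * z) • (1 : F →L[ℂ] F) := by
      have := NormedSpace.algebraMap_exp_comm (𝕂 := ℂ) (𝔸 := F →L[ℂ] F) ((t : ℂ) * z)
      rw [Algebra.algebraMap_eq_smul_one, Algebra.algebraMap_eq_smul_one] at this
      rw [← this, Complex.exp_eq_exp_ℂ]
    rw [h2]
    simp
  rw [hsplit, norm_smul, Complex.norm_exp]
  have hre : ((t : ℂ) * z).re = t * z.re := by simp
  rw [hre]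
  have hpow : (1 + t) ^ k ≤ k.factorial * Real.exp ε * (ε ^ k)⁻¹ * Real.exp (ε * t) := by
    have h1 := Real.pow_div_factorial_le_exp (ε * (1 + t)) (by positivity) k
    rw [div_le_iff₀ (by positivity), mul_pow, mul_add, mul_one, Real.exp_add] at h1
    calc (1 + t) ^ k = (ε ^ k)⁻¹ * (ε ^ k * (1 + t) ^ k) := by field_simp
      _ ≤ (ε ^ k)⁻¹ * (Real.exp ε * Real.exp (ε * t) * k.factorial) := by gcongr
      _ = _ := by ring
  calc Real.exp (t * z.re) * ‖NormedSpace.exp ((t : ℂ) • (B - z • 1)) v‖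
      ≤ Real.exp (t * z.re) *
        (K * (k.factorial * Real.exp ε * (ε ^ k)⁻¹ * Real.exp (ε * t))) := by
        gcongr
        exact (h t ht).trans (by gcongr)
    _ = K * (k.factorial * Real.exp ε * (ε ^ k)⁻¹) * (Real.exp (t * z.re) * Real.exp (ε * t)) := by
        ring
    _ = _ := by
        rw [← Real.exp_add]; congr 2; rw [hε]; ring

/-- If all eigenvalues of `B` lie to the left of `-μ`, then the flow of `B` decays at rate `μ`:
generalized eigenvectors decay, they span the space, and the uniform bound follows from the
pointwise ones by the Banach-Steinhaus theorem. -/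
lemma exists_norm_exp_le_of_eigenvalues [FiniteDimensional ℂ F] (B : F →L[ℂ] F) {μ : ℝ}
    (hB : ∀ z : ℂ, Module.End.HasEigenvalue (B : Module.End ℂ F) z → z.re < -μ) :
    ∃ K, 0 < K ∧ ∀ (t : ℝ), 0 ≤ t → ∀ v : F,
      ‖NormedSpace.exp ((t : ℂ) • B) v‖ ≤ K * Real.exp (-μ * t) * ‖v‖ := by
  let W : Submodule ℂ F :=
    { carrier := {v | ∃ K, 0 ≤ K ∧ ∀ t : ℝ, 0 ≤ t →
        ‖NormedSpace.exp ((t : ℂ) • B) v‖ ≤ K * Real.exp (-μ * t)}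
      zero_mem' := ⟨0, le_rfl, fun t _ => by simp⟩
      add_mem' := by
        rintro v w ⟨K, hK, h⟩ ⟨K', hK', h'⟩
        refine ⟨K + K', by positivity, fun t ht => ?_⟩
        rw [map_add, add_mul]
        exact (norm_add_le _ _).trans (add_le_add (h t ht) (h' t ht))
      smul_mem' := by
        rintro c v ⟨K, hK, h⟩
        refine ⟨‖c‖ * K, by positivity, fun t ht => ?_⟩
        rw [map_smul, norm_smul, mul_assoc]
        exact mul_le_mul_of_nonneg_left (h t ht) (norm_nonneg _) }
  have hW : W = ⊤ := by
    rw [eq_top_iff, ← Module.End.iSup_maxGenEigenspace_eq_top (B : Module.End ℂ F)]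
    refine iSup_le fun z v hv => ?_
    rw [Module.End.mem_maxGenEigenspace] at hv
    obtain ⟨k, hk⟩ := hv
    by_cases hz : Module.End.HasEigenvalue (B : Module.End ℂ F) z
    · refine exists_norm_exp_smul_le_exp B z (hB z hz) k v ?_
      have hcoe : ∀ j : ℕ, ∀ u : F, ((B - z • 1) ^ j) u
          = (((B : Module.End ℂ F) - z • 1) ^ j) u := by
        intro j
        induction j with
        | zero => intro u; simp
        | succ j ih => intro u; rw [pow_succ, pow_succ]; exact ih _
      rw [hcoe, hk]
    -- the generalized eigenspace is trivial unless `z` is an eigenvalue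
    · have : v = 0 := by
        by_contra hv0
        apply hz
        have hg : Module.End.HasUnifEigenvalue (B : Module.End ℂ F) z k := by
          intro hbot
          have : v ∈ Module.End.genEigenspace (B : Module.End ℂ F) z k := by
            rw [Module.End.mem_genEigenspace_nat]; exact hk
          rw [hbot] at this
          exact hv0 (by simpa using this)
        exact Module.End.hasEigenvalue_of_hasGenEigenvalue hg
      rw [this]; exact W.zero_mem
  have hpt : ∀ v : F, ∃ K, ∀ t : Set.Ici (0 : ℝ),
      ‖((Real.exp (μ * t) : ℂ) • NormedSpace.exp (((t : ℝ) : ℂ) • B)) v‖ ≤ K := by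
    intro v
    obtain ⟨K, _, h⟩ : v ∈ W := hW ▸ Submodule.mem_top
    refine ⟨K, fun t => ?_⟩
    have h1 := h t t.2
    rw [_root_.smul_apply, norm_smul, Complex.norm_real,
      Real.norm_eq_abs, Real.abs_exp]
    calc _ ≤ Real.exp (μ * t) * (K * Real.exp (-μ * t)) := by gcongr
      _ = K * (Real.exp (μ * t) * Real.exp (-μ * t)) := by ring
      _ = K := by rw [← Real.exp_add]; simp
  obtain ⟨K, hK⟩ := banach_steinhaus hpt
  refine ⟨max K 1, by positivity, fun t ht v => ?_⟩
  have h1 : ‖(Real.exp (μ * t) : ℂ) • NormedSpace.exp ((t : ℂ) • B)‖ ≤ K := hK ⟨t, ht⟩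
  rw [norm_smul, Complex.norm_real, Real.norm_eq_abs, Real.abs_exp] at h1
  have h2 : ‖NormedSpace.exp ((t : ℂ) • B)‖ ≤ max K 1 * Real.exp (-μ * t) := by
    calc _ = Real.exp (-μ * t) * (Real.exp (μ * t) * ‖NormedSpace.exp ((t : ℂ) • B)‖) := by
          rw [← mul_assoc, ← Real.exp_add]; simp
      _ ≤ Real.exp (-μ * t) * max K 1 := by gcongr; exact h1.trans (le_max_left _ _)
      _ = _ := mul_comm _ _
  exact (ContinuousLinearMap.le_opNorm _ _).trans (by gcongr)

end Decay

lemma exp_zero_smul_apply {F : Type*} [NormedAddCommGroup F] [NormedSpace ℝ F] (B : F →L[ℝ] F)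
    (v : F) : NormedSpace.exp ((0 : ℝ) • B) v = v := by
  simp

section Real

variable {F : Type*} [NormedAddCommGroup F] [NormedSpace ℝ F] [CompleteSpace F]

lemma hasDerivAt_exp_smul_real (B : F →L[ℝ] F) (v : F) (t : ℝ) :
    HasDerivAt (fun s : ℝ => NormedSpace.exp (s • B) v) (B (NormedSpace.exp (t • B) v)) t :=
  (ContinuousLinearMap.apply ℝ F v).hasFDerivAt.comp_hasDerivAt t
    (hasDerivAt_exp_smul_const' (𝕂 := ℝ) B t)

lemma continuous_exp_smul (B : F →L[ℝ] F) : Continuous fun s : ℝ => NormedSpace.exp (s • B) :=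
  continuous_iff_continuousAt.2 fun t => (hasDerivAt_exp_smul_const (𝕂 := ℝ) B t).continuousAt

/-- A continuous function whose derivative from the right satisfies `f' = B f` is given by the
flow of `B`. -/
lemma eq_exp_of_deriv_right (B : F →L[ℝ] F) {f : ℝ → F} {a b : ℝ}
    (hc : ContinuousOn f (Set.Icc a b))
    (hd : ∀ t ∈ Set.Ico a b, HasDerivWithinAt f (B (f t)) (Set.Ici t) t) :
    ∀ t ∈ Set.Icc a b, f t = NormedSpace.exp ((t - a) • B) (f a) := by
  have hg : ∀ t, HasDerivAt (fun s : ℝ => NormedSpace.exp ((s - a) • B) (f a))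
      (B (NormedSpace.exp ((t - a) • B) (f a))) t := fun t => by
    have h := (hasDerivAt_exp_smul_real B (f a) (t - a)).scomp t ((hasDerivAt_id t).sub_const a)
    rwa [one_smul] at h
  refine ODE_solution_unique (v := fun _ => B) (fun _ => B.lipschitz) hc hd
    (fun t _ => (hg t).continuousAt.continuousWithinAt) (fun t _ => (hg t).hasDerivWithinAt) ?_
  simp

end Real

/-- The flow `exp (tX)` of a real matrix, as a continuous linear map. -/
def flow {q : ℕ} (X : Matrix (Fin q) (Fin q) ℝ) (t : ℝ) : E q →L[ℝ] E q :=
  NormedSpace.exp (t • (toEuclideanLin X).toContinuousLinearMap)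

lemma toEuclideanLin_exp {q : ℕ} (X : Matrix (Fin q) (Fin q) ℝ) (t : ℝ) (v : E q) :
    toEuclideanLin (NormedSpace.exp (t • X)) v = flow X t v := by
  have hc : Continuous (Matrix.toEuclideanCLM (n := Fin q) (𝕜 := ℝ)) :=
    LinearMap.continuous_of_finiteDimensional
      (Matrix.toEuclideanCLM (n := Fin q) (𝕜 := ℝ)).toAlgEquiv.toLinearMap
  let _ : NormedRing (Matrix (Fin q) (Fin q) ℝ) := Matrix.linftyOpNormedRing
  let _ : NormedAlgebra ℝ (Matrix (Fin q) (Fin q) ℝ) := Matrix.linftyOpNormedAlgebra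
  let _ : NormedAlgebra ℚ (Matrix (Fin q) (Fin q) ℝ) := .restrictScalars ℚ ℝ _
  have h := NormedSpace.map_exp (Matrix.toEuclideanCLM (n := Fin q) (𝕜 := ℝ)) hc (t • X)
  rw [map_smul] at h
  exact DFunLike.congr_fun h v

lemma hasDerivAt_flow {q : ℕ} (X : Matrix (Fin q) (Fin q) ℝ) (v : E q) (t : ℝ) :
    HasDerivAt (fun s => flow X s v) (toEuclideanLin X (flow X t v)) t :=
  hasDerivAt_exp_smul_real _ v t

@[simp] lemma flow_zero {q : ℕ} (X : Matrix (Fin q) (Fin q) ℝ) (v : E q) : flow X 0 v = v :=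
  exp_zero_smul_apply _ v

lemma continuous_flow {q : ℕ} (X : Matrix (Fin q) (Fin q) ℝ) : Continuous (flow X) :=
  continuous_exp_smul _

lemma eq_flow_of_deriv_right {q : ℕ} (X : Matrix (Fin q) (Fin q) ℝ) {f : ℝ → E q} {a b : ℝ}
    (hc : ContinuousOn f (Set.Icc a b))
    (hd : ∀ t ∈ Set.Ico a b, HasDerivWithinAt f (toEuclideanLin X (f t)) (Set.Ici t) t) :
    ∀ t ∈ Set.Icc a b, f t = flow X (t - a) (f a) :=
  eq_exp_of_deriv_right (toEuclideanLin X).toContinuousLinearMap hc hd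

/-- Coordinatewise inclusion of a real vector into complex space. -/
def complexify {q : ℕ} (v : E q) : EuclideanSpace ℂ (Fin q) := WithLp.toLp 2 fun r => (v r : ℂ)

lemma norm_complexify {q : ℕ} (v : E q) : ‖complexify v‖ = ‖v‖ := by
  simp [complexify, EuclideanSpace.norm_eq]

/-- The flow of a Hurwitz matrix decays exponentially. -/
lemma IsHurwitz.exists_flow_le {q : ℕ} {X : Matrix (Fin q) (Fin q) ℝ} (hX : IsHurwitz X) :
    ∃ K μ : ℝ, 0 < K ∧ 0 < μ ∧ ∀ t, 0 ≤ t → ∀ v, ‖flow X t v‖ ≤ K * Real.exp (-μ * t) * ‖v‖ := by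
  set Y : Matrix (Fin q) (Fin q) ℂ := X.map Complex.ofReal with hY
  have hfin : (spectrum ℂ Y).Finite := Matrix.finite_spectrum Y
  obtain ⟨μ, hμ, hs⟩ : ∃ μ : ℝ, 0 < μ ∧ ∀ z ∈ spectrum ℂ Y, z.re < -μ := by
    by_cases hne : (spectrum ℂ Y).Nonempty
    · obtain ⟨z₀, hz₀, hmax⟩ := hfin.exists_maximalFor Complex.re _ hne
      have h0 := hX z₀ hz₀
      refine ⟨-z₀.re / 2, by linarith, fun z hz => ?_⟩
      rcases le_total z.re z₀.re with h | h
      · linarith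
      · have := hmax hz h; linarith
    · exact ⟨1, one_pos, fun z hz => absurd ⟨z, hz⟩ hne⟩
  set B : EuclideanSpace ℂ (Fin q) →L[ℂ] EuclideanSpace ℂ (Fin q) :=
    (toEuclideanLin Y).toContinuousLinearMap
  obtain ⟨K, hK, h⟩ := exists_norm_exp_le_of_eigenvalues B (μ := μ) (fun z hz => by
    refine hs z ?_
    rw [← Matrix.spectrum_toLpLin 2]
    exact Module.End.hasEigenvalue_iff_mem_spectrum.1 hz)
  refine ⟨K, μ, hK, hμ, fun t ht v => ?_⟩
  have hB : ∀ u : E q, B (complexify u) = complexify (toEuclideanLin X u) := by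
    intro u
    ext r
    change (Y *ᵥ _) r = (((X *ᵥ _) r : ℝ) : ℂ)
    simp [mulVec, dotProduct, hY, complexify]
  -- the complexified flow and the flow of the complexified matrix solve the same equation
  have heq : complexify (flow X t v) = NormedSpace.exp ((t : ℂ) • B) (complexify v) := by
    let J : E q →ₗ[ℝ] EuclideanSpace ℂ (Fin q) :=
      { toFun := complexify
        map_add' := fun a b => by ext r; simp [complexify]
        map_smul' := fun c a => by ext r; simp [complexify] }
    let J' : E q →L[ℝ] EuclideanSpace ℂ (Fin q) := ⟨J, J.continuous_of_finiteDimensional⟩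
    have hf : ∀ s, HasDerivAt (fun s => complexify (flow X s v)) (B (complexify (flow X s v))) s := by
      intro s
      rw [hB]
      exact J'.hasFDerivAt.comp_hasDerivAt s (hasDerivAt_flow X v s)
    have hg := hasDerivAt_exp_smul_apply' B (complexify v)
    refine ODE_solution_unique (v := fun _ => B) (fun _ => B.lipschitz) (a := 0) (b := t)
      (fun s _ => (hf s).continuousAt.continuousWithinAt) (fun s _ => (hf s).hasDerivWithinAt)
      (fun s _ => (hg s).continuousAt.continuousWithinAt) (fun s _ => (hg s).hasDerivWithinAt)
      ?_ ⟨ht, le_rfl⟩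
    simp
  rw [← norm_complexify, heq, ← norm_complexify v]
  exact h t ht _

/-! ### The undetectable subspace -/

lemma toEuclideanLin_mul_apply {a b c : Type*} [Fintype a] [Fintype b] [Fintype c] [DecidableEq b]
    [DecidableEq c] (X : Matrix a b ℝ) (Y : Matrix b c ℝ) (v : EuclideanSpace ℝ c) :
    toEuclideanLin (X * Y) v = toEuclideanLin X (toEuclideanLin Y v) := by
  ext r
  simp [mulVec_mulVec]

lemma toEuclideanLin_one_apply {a : Type*} [Fintype a] [DecidableEq a] (v : EuclideanSpace ℝ a) :
    toEuclideanLin (1 : Matrix a a ℝ) v = v := by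
  ext r
  simp

lemma inner_toEuclideanLin_left {a b : Type*} [Fintype a] [Fintype b] [DecidableEq a]
    [DecidableEq b] (X : Matrix a b ℝ) (v : EuclideanSpace ℝ b) (w : EuclideanSpace ℝ a) :
    inner ℝ (toEuclideanLin X v) w = inner ℝ v (toEuclideanLin Xᵀ w) := by
  rw [← conjTranspose_eq_transpose_of_trivial, toEuclideanLin_conjTranspose_eq_adjoint,
    LinearMap.adjoint_inner_right]

lemma lin_pow_eq_zero_of_mem_undetectable {n : ℕ} {r : Type*} [Fintype r]
    {A : Matrix (Fin n) (Fin n) ℝ} {H : Matrix r (Fin n) ℝ} {v : E n}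
    (hv : v ∈ undetectableSubspace A H) (k : ℕ) : toEuclideanLin (H * A ^ k) v = 0 := by
  rcases Nat.eq_zero_or_pos n with rfl | hn
  · rw [Subsingleton.elim v 0, map_zero]
  have hv' : ∀ j < n, toEuclideanLin (H * A ^ j) v = 0 := fun j hj =>
    (Submodule.mem_iInf _).1 hv.1 ⟨j, hj⟩
  have : Nonempty (Fin n) := ⟨⟨0, hn⟩⟩
  have hdeg : (Polynomial.X ^ k %ₘ A.charpoly).natDegree < n := by
    have h := Polynomial.natDegree_modByMonic_lt (Polynomial.X ^ k) A.charpoly_monic (by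
      intro h1
      have h2 := A.charpoly_natDegree_eq_dim
      rw [h1] at h2
      simp at h2
      omega)
    simpa [A.charpoly_natDegree_eq_dim] using h
  rw [pow_eq_aeval_mod_charpoly, Polynomial.aeval_eq_sum_range' hdeg, Matrix.mul_sum, map_sum,
    LinearMap.sum_apply]
  refine Finset.sum_eq_zero fun j hj => ?_
  rw [Matrix.mul_smul, map_smul, LinearMap.smul_apply, hv' j (Finset.mem_range.1 hj), smul_zero]

lemma lin_eq_zero_of_mem_undetectable {n : ℕ} {r : Type*} [Fintype r]
    {A : Matrix (Fin n) (Fin n) ℝ} {H : Matrix r (Fin n) ℝ} {v : E n}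
    (hv : v ∈ undetectableSubspace A H) : toEuclideanLin H v = 0 := by
  simpa using lin_pow_eq_zero_of_mem_undetectable hv 0

/-- The undetectable subspace is invariant under `A`, by the Cayley-Hamilton theorem. -/
lemma lin_mem_undetectable {n : ℕ} {r : Type*} [Fintype r]
    {A : Matrix (Fin n) (Fin n) ℝ} {H : Matrix r (Fin n) ℝ} {v : E n}
    (hv : v ∈ undetectableSubspace A H) : toEuclideanLin A v ∈ undetectableSubspace A H := by
  refine ⟨(Submodule.mem_iInf _).2 fun k => ?_, ?_⟩
  · have h := lin_pow_eq_zero_of_mem_undetectable hv (k + 1)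
    rw [LinearMap.mem_ker, ← toEuclideanLin_mul_apply, Matrix.mul_assoc, ← pow_succ]
    exact h
  · have h : (Polynomial.aeval (A.map Complex.ofReal) (closedRightFactor A)) *ᵥ
        (fun r => (v r : ℂ)) = 0 := hv.2
    have hA : (fun r => ((toEuclideanLin A v r : ℝ) : ℂ))
        = A.map Complex.ofReal *ᵥ (fun r => (v r : ℂ)) := by
      ext r
      simp [toLpLin_apply, mulVec, dotProduct]
    have hcomm : Commute (Polynomial.aeval (A.map Complex.ofReal) (closedRightFactor A))
        (A.map Complex.ofReal) := by
      have h1 := congrArg (Polynomial.aeval (A.map Complex.ofReal))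
        (mul_comm (closedRightFactor A) Polynomial.X)
      rwa [map_mul, map_mul, Polynomial.aeval_X] at h1
    change (Polynomial.aeval (A.map Complex.ofReal) (closedRightFactor A)) *ᵥ
        (fun r => ((toEuclideanLin A v r : ℝ) : ℂ)) = 0
    rw [hA, mulVec_mulVec, hcomm.eq, ← mulVec_mulVec, h, mulVec_zero]

/-- The matrix whose columns are an orthonormal basis of a subspace. -/
def basisMatrix {n k : ℕ} {K : Submodule ℝ (E n)} (b : OrthonormalBasis (Fin k) ℝ K) :
    Matrix (Fin n) (Fin k) ℝ := Matrix.of fun r s => (b s : E n) r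

lemma basisMatrix_transpose_mul {n k l : ℕ} {K K' : Submodule ℝ (E n)}
    (b : OrthonormalBasis (Fin k) ℝ K) (b' : OrthonormalBasis (Fin l) ℝ K') :
    (basisMatrix b)ᵀ * basisMatrix b' = Matrix.of fun s s' => inner ℝ (b s : E n) (b' s' : E n) := by
  ext s s'
  simp [Matrix.mul_apply, basisMatrix, PiLp.inner_apply, mul_comm]

lemma basisMatrix_transpose_mul_self {n k : ℕ} {K : Submodule ℝ (E n)}
    (b : OrthonormalBasis (Fin k) ℝ K) : (basisMatrix b)ᵀ * basisMatrix b = 1 := by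
  rw [basisMatrix_transpose_mul]
  ext s s'
  have h := orthonormal_iff_ite.1 b.orthonormal s s'
  rw [of_apply, one_apply, ← h]
  rfl

lemma toEuclideanLin_basisMatrix {n k : ℕ} {K : Submodule ℝ (E n)}
    (b : OrthonormalBasis (Fin k) ℝ K) (u : E k) :
    toEuclideanLin (basisMatrix b) u = ∑ s, u s • (b s : E n) := by
  ext r
  simp [toLpLin_apply, mulVec, dotProduct, basisMatrix, mul_comm]

lemma toEuclideanLin_basisMatrix_transpose {n k : ℕ} {K : Submodule ℝ (E n)}
    (b : OrthonormalBasis (Fin k) ℝ K) (v : E n) (s : Fin k) :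
    toEuclideanLin (basisMatrix b)ᵀ v s = inner ℝ (b s : E n) v := by
  simp [toLpLin_apply, mulVec, dotProduct, basisMatrix, PiLp.inner_apply, mul_comm]

lemma toEuclideanLin_basisMatrix_mem {n k : ℕ} {K : Submodule ℝ (E n)}
    (b : OrthonormalBasis (Fin k) ℝ K) (u : E k) : toEuclideanLin (basisMatrix b) u ∈ K := by
  rw [toEuclideanLin_basisMatrix]
  exact K.sum_mem fun s _ => K.smul_mem _ (b s).2

lemma toEuclideanLin_basisMatrix_mul_transpose {n k : ℕ} {K : Submodule ℝ (E n)}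
    (b : OrthonormalBasis (Fin k) ℝ K) (v : E n) :
    toEuclideanLin (basisMatrix b) (toEuclideanLin (basisMatrix b)ᵀ v) = K.starProjection v := by
  rw [toEuclideanLin_basisMatrix, Submodule.starProjection_apply,
    b.orthogonalProjectionOnto_apply_eq_sum]
  simp [toEuclideanLin_basisMatrix_transpose]

namespace Design

/-! ### Undetectable and detectable coordinates of an agent -/

variable {ι : Type*} [Fintype ι] {n : ℕ} {m : ι → ℕ} (S : Design ι n m) (i : ι)

lemma D_eq : S.D i = basisMatrix (S.basisD i) := rfl

lemma U_eq : S.U i = basisMatrix (S.basisU i) := rfl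

lemma Ad_eq : S.Ad i = (S.D i)ᵀ * S.A * S.D i := by
  simp [Ad, T, transpose_fromCols, fromRows_mul]

lemma Au_eq : S.Au i = (S.U i)ᵀ * S.A * S.U i := by
  simp [Au, T, transpose_fromCols, fromRows_mul]

lemma Hd_eq : S.Hd i = S.H i * S.D i := by
  simp [Hd, T, mul_fromCols]

lemma L_eq : S.L i = S.D i * S.Ld i := by
  have h : fromCols (S.D i) (S.U i) * fromRows (S.Ld i) (0 : Matrix (Fin (S.p i)) (Fin (m i)) ℝ)
      = S.D i * S.Ld i := by
    rw [fromCols_mul_fromRows, Matrix.mul_zero, add_zero]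
  exact h

lemma M_eq : S.M i = S.U i * (S.U i)ᵀ := by
  simp [M, T, transpose_fromCols, fromCols_mul_fromBlocks, fromCols_mul_fromRows]

/-- The undetectable coordinates `Uᵀ v`. -/
def uc : E n →L[ℝ] E (S.p i) := (toEuclideanLin (S.U i)ᵀ).toContinuousLinearMap

/-- The detectable coordinates `Dᵀ v`. -/
def dc : E n →L[ℝ] E (S.q i) := (toEuclideanLin (S.D i)ᵀ).toContinuousLinearMap

/-- The vector with given undetectable coordinates. -/
def um : E (S.p i) →L[ℝ] E n := (toEuclideanLin (S.U i)).toContinuousLinearMap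

/-- The vector with given detectable coordinates. -/
def dm : E (S.q i) →L[ℝ] E n := (toEuclideanLin (S.D i)).toContinuousLinearMap

lemma um_mem (u : E (S.p i)) : S.um i u ∈ undetectableSubspace S.A (S.H i) :=
  toEuclideanLin_basisMatrix_mem (S.basisU i) u

lemma dm_mem (d : E (S.q i)) : S.dm i d ∈ (undetectableSubspace S.A (S.H i))ᗮ :=
  toEuclideanLin_basisMatrix_mem (S.basisD i) d

lemma uc_um (u : E (S.p i)) : S.uc i (S.um i u) = u := by
  change toEuclideanLin (S.U i)ᵀ (toEuclideanLin (S.U i) u) = u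
  rw [← toEuclideanLin_mul_apply, U_eq, basisMatrix_transpose_mul_self, toEuclideanLin_one_apply]

lemma dc_dm (d : E (S.q i)) : S.dc i (S.dm i d) = d := by
  change toEuclideanLin (S.D i)ᵀ (toEuclideanLin (S.D i) d) = d
  rw [← toEuclideanLin_mul_apply, D_eq, basisMatrix_transpose_mul_self, toEuclideanLin_one_apply]

lemma uc_eq_zero {v : E n} (hv : v ∈ (undetectableSubspace S.A (S.H i))ᗮ) : S.uc i v = 0 := by
  ext s
  exact (toEuclideanLin_basisMatrix_transpose (S.basisU i) v s).trans
    (Submodule.inner_right_of_mem_orthogonal (S.basisU i s).2 hv)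

lemma dc_eq_zero {v : E n} (hv : v ∈ undetectableSubspace S.A (S.H i)) : S.dc i v = 0 := by
  ext s
  exact (toEuclideanLin_basisMatrix_transpose (S.basisD i) v s).trans
    (Submodule.inner_left_of_mem_orthogonal hv (S.basisD i s).2)

lemma um_uc_add_dm_dc (v : E n) : S.um i (S.uc i v) + S.dm i (S.dc i v) = v := by
  have h1 := toEuclideanLin_basisMatrix_mul_transpose (S.basisU i) v
  have h2 := toEuclideanLin_basisMatrix_mul_transpose (S.basisD i) v
  change toEuclideanLin (basisMatrix (S.basisU i)) (toEuclideanLin (basisMatrix (S.basisU i))ᵀ v)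
    + toEuclideanLin (basisMatrix (S.basisD i)) (toEuclideanLin (basisMatrix (S.basisD i))ᵀ v) = v
  rw [h1, h2]
  exact Submodule.starProjection_add_starProjection_orthogonal _

lemma inner_um (u : E (S.p i)) (v : E n) : inner ℝ (S.um i u) v = inner ℝ u (S.uc i v) :=
  inner_toEuclideanLin_left (S.U i) u v

lemma norm_um (u : E (S.p i)) : ‖S.um i u‖ = ‖u‖ := by
  rw [← sq_eq_sq₀ (norm_nonneg _) (norm_nonneg _), ← real_inner_self_eq_norm_sq, inner_um, uc_um,
    real_inner_self_eq_norm_sq]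

lemma norm_dm (d : E (S.q i)) : ‖S.dm i d‖ = ‖d‖ := by
  rw [← sq_eq_sq₀ (norm_nonneg _) (norm_nonneg _), ← real_inner_self_eq_norm_sq]
  have h : inner ℝ (S.dm i d) (S.dm i d) = inner ℝ d (S.dc i (S.dm i d)) :=
    inner_toEuclideanLin_left (S.D i) d _
  rw [h, dc_dm, real_inner_self_eq_norm_sq]

lemma norm_sq_eq (v : E n) : ‖v‖ ^ 2 = ‖S.uc i v‖ ^ 2 + ‖S.dc i v‖ ^ 2 := by
  have h : inner ℝ (S.um i (S.uc i v)) (S.dm i (S.dc i v)) = 0 :=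
    Submodule.inner_right_of_mem_orthogonal (S.um_mem i _) (S.dm_mem i _)
  conv_lhs => rw [← S.um_uc_add_dm_dc i v]
  rw [norm_add_sq_real, h, norm_um, norm_dm]
  ring

/-- The detectable coordinates are driven by themselves alone: `Dᵀ A = A_d Dᵀ`. -/
lemma dc_A (v : E n) : S.dc i (toEuclideanLin S.A v) = toEuclideanLin (S.Ad i) (S.dc i v) := by
  conv_lhs => rw [← S.um_uc_add_dm_dc i v]
  rw [map_add, map_add, S.dc_eq_zero i (lin_mem_undetectable (S.um_mem i _)), zero_add, Ad_eq,
    toEuclideanLin_mul_apply, toEuclideanLin_mul_apply]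
  rfl

lemma H_eq_Hd (v : E n) : toEuclideanLin (S.H i) v = toEuclideanLin (S.Hd i) (S.dc i v) := by
  conv_lhs => rw [← S.um_uc_add_dm_dc i v]
  rw [map_add, lin_eq_zero_of_mem_undetectable (S.um_mem i _), zero_add, Hd_eq,
    toEuclideanLin_mul_apply]
  rfl

lemma L_apply (y : E (m i)) : toEuclideanLin (S.L i) y = S.dm i (toEuclideanLin (S.Ld i) y) := by
  rw [L_eq, toEuclideanLin_mul_apply]; rfl

lemma M_apply (v : E n) : toEuclideanLin (S.M i) v = S.um i (S.uc i v) := by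
  rw [M_eq, toEuclideanLin_mul_apply]; rfl

lemma uc_A_um (u : E (S.p i)) :
    S.uc i (toEuclideanLin S.A (S.um i u)) = toEuclideanLin (S.Au i) u := by
  rw [Au_eq, toEuclideanLin_mul_apply, toEuclideanLin_mul_apply]; rfl

end Design

/-! ### Coercivity of the Laplacian on the undetectable directions -/

/-- The smallest eigenvalue of a positive definite matrix is positive and bounds its quadratic
form from below. -/
lemma lambdaMin_pos_and_le {a : Type*} [Fintype a] [DecidableEq a] [Nonempty a] {X : Matrix a a ℝ}
    (hX : X.PosDef) : 0 < lambdaMin X ∧ ∀ u : a → ℝ, lambdaMin X * (u ⬝ᵥ u) ≤ u ⬝ᵥ (X *ᵥ u) := by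
  have hfin : (spectrum ℝ X).Finite := finite_real_spectrum (𝕜 := ℝ)
  have hne : (spectrum ℝ X).Nonempty := by
    rw [hX.isHermitian.spectrum_real_eq_range_eigenvalues]
    exact Set.range_nonempty _
  have hpos : 0 < lambdaMin X := by
    have hmem : lambdaMin X ∈ spectrum ℝ X := hne.csInf_mem hfin
    rw [hX.isHermitian.spectrum_real_eq_range_eigenvalues] at hmem
    obtain ⟨k, hk⟩ := hmem
    exact hk ▸ hX.eigenvalues_pos k
  refine ⟨hpos, fun u => ?_⟩
  have hps : (X - lambdaMin X • (1 : Matrix a a ℝ)).PosSemidef := by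
    rw [posSemidef_iff_isHermitian_and_spectrum_nonneg]
    refine ⟨hX.isHermitian.sub (by simp [IsHermitian]), fun s hs => ?_⟩
    rw [← Algebra.algebraMap_eq_smul_one, ← spectrum.sub_singleton_eq] at hs
    obtain ⟨s', hs', r, rfl, rfl⟩ := hs
    exact sub_nonneg.2 (csInf_le hfin.bddBelow hs')
  have h := hps.dotProduct_mulVec_nonneg u
  rw [sub_mulVec, dotProduct_sub, smul_mulVec, one_mulVec, dotProduct_smul, star_trivial] at h
  simpa using h

lemma blockDiagonal'_mulVec_apply {ι : Type*} [Fintype ι] [DecidableEq ι] {a b : ι → Type*}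
    [∀ i, Fintype (b i)] (X : ∀ i, Matrix (a i) (b i) ℝ) (u : (Σ i, b i) → ℝ) (i : ι) (r : a i) :
    (blockDiagonal' X *ᵥ u) ⟨i, r⟩ = (X i *ᵥ fun s => u ⟨i, s⟩) r := by
  simp only [mulVec, dotProduct, Fintype.sum_sigma, blockDiagonal'_apply]
  rw [Finset.sum_eq_single i]
  · simp
  · intro j _ hj
    exact Finset.sum_eq_zero fun s _ => by rw [dif_neg (Ne.symm hj), zero_mul]
  · simp

lemma inner_eq_dotProduct {a : Type*} [Fintype a] (v w : EuclideanSpace ℝ a) :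
    inner ℝ v w = (fun r => v r) ⬝ᵥ fun r => w r := by
  simp [PiLp.inner_apply, dotProduct, mul_comm]

namespace Design

variable {ι : Type*} [Fintype ι] {n : ℕ} {m : ι → ℕ} (S : Design ι n m)

lemma weight_nonneg (i j : ι) : 0 ≤ S.net.a i j := by
  by_cases h : S.net.graph.Adj i j
  · exact (S.net.a_pos i j h).le
  · exact (S.net.a_zero i j h).ge

lemma weight_self (i : ι) : S.net.a i i = 0 := S.net.a_zero i i (S.net.graph.irrefl)

lemma disagreement_nonneg (i : ι) (z : E n) (w : ι → E n) : 0 ≤ S.disagreement i z w :=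
  Finset.sum_nonneg fun j _ => mul_nonneg (S.weight_nonneg i j) (by positivity)

/-- The bilinear form `vᵀ (ℒ ⊗ I) w` of the Laplacian. -/
def coupling (v w : ι → E n) : ℝ := ∑ i, inner ℝ (v i) (∑ j, S.net.a i j • (w i - w j))

lemma coupling_eq (v w : ι → E n) :
    S.coupling v w = 1 / 2 * ∑ i, ∑ j, S.net.a i j * inner ℝ (v i - v j) (w i - w j) := by
  have h1 : S.coupling v w = ∑ i, ∑ j, S.net.a i j * inner ℝ (v i) (w i - w j) := by
    simp only [coupling, inner_sum, inner_smul_right]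
  have h2 : S.coupling v w = ∑ i, ∑ j, S.net.a i j * inner ℝ (v j) (w j - w i) := by
    rw [h1, Finset.sum_comm]
    exact Finset.sum_congr rfl fun i _ => Finset.sum_congr rfl fun j _ => by rw [S.net.a_symm]
  have h3 : S.coupling v w + S.coupling v w
      = ∑ i, ∑ j, S.net.a i j * inner ℝ (v i - v j) (w i - w j) := by
    nth_rewrite 1 [h1]
    rw [h2, ← Finset.sum_add_distrib]
    refine Finset.sum_congr rfl fun i _ => ?_
    rw [← Finset.sum_add_distrib]
    refine Finset.sum_congr rfl fun j _ => ?_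
    rw [← mul_add, ← neg_sub (w i) (w j), inner_neg_right, inner_sub_left, ← sub_eq_add_neg]
  rw [← h3]; ring

lemma coupling_self (v : ι → E n) :
    S.coupling v v = 1 / 2 * ∑ i, S.disagreement i (v i) v := by
  simp only [coupling_eq, disagreement, real_inner_self_eq_norm_sq]

lemma coupling_self_nonneg (v : ι → E n) : 0 ≤ S.coupling v v := by
  rw [coupling_self]
  exact mul_nonneg (by norm_num) (Finset.sum_nonneg fun i _ => S.disagreement_nonneg i _ _)

lemma eq_of_coupling_self_eq_zero (hconn : S.net.graph.Connected) {v : ι → E n}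
    (h : S.coupling v v = 0) (i j : ι) : v i = v j := by
  rw [coupling_self, mul_eq_zero, or_iff_right (by norm_num),
    Finset.sum_eq_zero_iff_of_nonneg fun i _ => S.disagreement_nonneg i _ _] at h
  have hadj : ∀ i j, S.net.graph.Adj i j → v i = v j := by
    intro i j hij
    have h1 := h i (Finset.mem_univ i)
    rw [disagreement, Finset.sum_eq_zero_iff_of_nonneg fun j _ =>
      mul_nonneg (S.weight_nonneg i j) (by positivity)] at h1
    have h2 := h1 j (Finset.mem_univ j)
    rw [mul_eq_zero, or_iff_right (S.net.a_pos i j hij).ne'] at h2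
    simpa [sub_eq_zero] using h2
  obtain ⟨p⟩ := hconn.preconnected i j
  induction p with
  | nil => rfl
  | cons hij _ ih => exact (hadj _ _ hij).trans ih

lemma mem_undetectable_stacked {v : E n} [Nonempty ι]
    (hv : ∀ i, v ∈ undetectableSubspace S.A (S.H i)) :
    v ∈ undetectableSubspace S.A S.stackedH := by
  refine ⟨(Submodule.mem_iInf _).2 fun k => ?_, (hv (Classical.arbitrary ι)).2⟩
  rw [LinearMap.mem_ker]
  ext ⟨i, r⟩
  have h := lin_pow_eq_zero_of_mem_undetectable (hv i) k
  have h1 := congrArg (fun w : E (m i) => w r) h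
  rw [toEuclideanLin_mul_apply] at h1 ⊢
  exact h1

/-- The undetectable coordinates of all agents, stacked into one vector. -/
def stack (u : ∀ i, E (S.p i)) : (Σ i, Fin (S.p i)) → ℝ := fun x => u x.1 x.2

lemma stack_dotProduct_self (u : ∀ i, E (S.p i)) :
    S.stack u ⬝ᵥ S.stack u = ∑ i, ‖u i‖ ^ 2 := by
  simp only [EuclideanSpace.norm_sq_eq]
  simp [stack, dotProduct, Fintype.sum_sigma, sq]

variable [DecidableEq ι]

lemma laplacian_self (i : ι) : S.net.laplacian i i = ∑ j, S.net.a i j := by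
  simp [WeightedGraph.laplacian]

lemma laplacian_self_nonneg (i : ι) : 0 ≤ S.net.laplacian i i := by
  rw [laplacian_self]
  exact Finset.sum_nonneg fun j _ => S.weight_nonneg i j

lemma sum_laplacian_smul (w : ι → E n) (i : ι) :
    ∑ j, S.net.laplacian i j • w j = ∑ j, S.net.a i j • (w i - w j) := by
  have h : ∀ j, S.net.laplacian i j • w j
      = (if i = j then (∑ k, S.net.a i k) • w i else 0) - S.net.a i j • w j := by
    intro j
    by_cases hij : i = j
    · subst hij
      simp [laplacian_self, S.weight_self]
    · simp [WeightedGraph.laplacian, hij]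
  simp only [h, smul_sub, Finset.sum_sub_distrib, Finset.sum_ite_eq, Finset.mem_univ, if_true,
    Finset.sum_smul]

lemma laplacianKron_mulVec (y : ι → E n) (i : ι) (r : Fin n) :
    (S.laplacianKron *ᵥ fun x => y x.1 x.2) ⟨i, r⟩ = (∑ j, S.net.a i j • (y i - y j)) r := by
  rw [← sum_laplacian_smul]
  simp [mulVec, dotProduct, laplacianKron, Fintype.sum_sigma, kroneckerMap_apply, one_apply]

lemma laplacianKron_transpose : S.laplacianKronᵀ = S.laplacianKron := by
  ext ⟨i, r⟩ ⟨j, s⟩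
  simp only [laplacianKron, transpose_apply, submatrix_apply, kroneckerMap_apply,
    WeightedGraph.laplacian, of_apply, Equiv.sigmaEquivProd_apply, one_apply, S.net.a_symm i j,
    eq_comm (a := i) (b := j), eq_comm (a := r) (b := s)]
  by_cases h : j = i
  · subst h; rfl
  · simp [h]

lemma stack_dotProduct_AuAll (u : ∀ i, E (S.p i)) :
    S.stack u ⬝ᵥ (S.AuAll *ᵥ S.stack u) = ∑ i, inner ℝ (u i) (toEuclideanLin (S.Au i) (u i)) := by
  rw [dotProduct, Fintype.sum_sigma]
  refine Finset.sum_congr rfl fun i _ => ?_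
  rw [inner_eq_dotProduct, dotProduct]
  refine Finset.sum_congr rfl fun r _ => ?_
  rw [AuAll, blockDiagonal'_mulVec_apply]
  rfl

lemma stack_dotProduct_laplacian (u : ∀ i, E (S.p i)) :
    S.stack u ⬝ᵥ ((S.UAllᵀ * S.laplacianKron * S.UAll) *ᵥ S.stack u)
      = S.coupling (fun i => S.um i (u i)) (fun i => S.um i (u i)) := by
  have hU : S.UAll *ᵥ S.stack u = fun x => S.um x.1 (u x.1) x.2 := by
    ext ⟨i, r⟩
    rw [UAll, blockDiagonal'_mulVec_apply]
    rfl
  rw [← mulVec_mulVec, ← mulVec_mulVec, hU, dotProduct_mulVec, vecMul_transpose, hU, dotProduct,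
    Fintype.sum_sigma, coupling]
  refine Finset.sum_congr rfl fun i _ => ?_
  rw [inner_eq_dotProduct, dotProduct]
  refine Finset.sum_congr rfl fun r _ => ?_
  rw [S.laplacianKron_mulVec fun i => S.um i (u i)]

/-- Joint detectability and connectedness make the Laplacian positive definite on the product of
the undetectable subspaces: a vector in its kernel consists of equal copies of a vector that is
undetectable for every agent. -/
lemma posDef_laplacian (hconn : S.net.graph.Connected) (hdet : Detectable S.A S.stackedH) :
    (S.UAllᵀ * S.laplacianKron * S.UAll).PosDef := by
  refine PosDef.of_dotProduct_mulVec_pos ?_ fun x hx => ?_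
  · rw [IsHermitian, conjTranspose_eq_transpose_of_trivial, transpose_mul, transpose_mul,
      transpose_transpose, laplacianKron_transpose, Matrix.mul_assoc]
  · obtain ⟨u, rfl⟩ : ∃ u, x = S.stack u := ⟨fun i => WithLp.toLp 2 fun r => x ⟨i, r⟩, rfl⟩
    rw [star_trivial, stack_dotProduct_laplacian]
    refine lt_of_le_of_ne (S.coupling_self_nonneg _) fun h0 => hx ?_
    have heq := S.eq_of_coupling_self_eq_zero hconn h0.symm
    have := hconn.nonempty
    have hzero : ∀ i, S.um i (u i) = 0 := by
      intro i
      have hmem : S.um i (u i) ∈ undetectableSubspace S.A S.stackedH :=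
        S.mem_undetectable_stacked fun j => by
          have h : S.um i (u i) = S.um j (u j) := heq i j
          rw [h]
          exact S.um_mem j _
      rw [hdet] at hmem
      simpa using hmem
    ext ⟨i, r⟩
    have h := S.uc_um i (u i)
    rw [hzero i, map_zero] at h
    simp [stack, ← h]

/-- What the lower bound on the coupling gain `c` provides: the consensus term dominates the
growth of the undetectable coordinates. -/
lemma exists_coercive (hconn : S.net.graph.Connected) (hdet : Detectable S.A S.stackedH)
    (hadm : S.Admissible) :
    0 ≤ S.c ∧ ∃ a : ℝ, ∀ u : ∀ i, E (S.p i),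
      2 * ∑ i, inner ℝ (u i) (toEuclideanLin (S.Au i) (u i)) ≤ a * ∑ i, ‖u i‖ ^ 2 ∧
      2 * (2 + a) * ∑ i, ‖u i‖ ^ 2
        ≤ S.c * S.coupling (fun i => S.um i (u i)) (fun i => S.um i (u i)) := by
  have hc := hadm.c_bound
  set a := norm2 (S.AuAll + S.AuAllᵀ) with ha
  have ha0 : 0 ≤ a := norm_nonneg _
  have hA : ∀ u : ∀ i, E (S.p i),
      2 * ∑ i, inner ℝ (u i) (toEuclideanLin (S.Au i) (u i)) ≤ a * ∑ i, ‖u i‖ ^ 2 := by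
    intro u
    set w : EuclideanSpace ℝ (Σ i, Fin (S.p i)) := WithLp.toLp 2 (S.stack u) with hw
    have h1 : 2 * ∑ i, inner ℝ (u i) (toEuclideanLin (S.Au i) (u i))
        = inner ℝ w (toEuclideanCLM (𝕜 := ℝ) (S.AuAll + S.AuAllᵀ) w) := by
      rw [inner_toEuclideanCLM, add_mulVec, dotProduct_add, hw]
      rw [dotProduct_mulVec _ S.AuAllᵀ, vecMul_transpose, dotProduct_comm (S.AuAll *ᵥ _),
        stack_dotProduct_AuAll]
      ring
    have h2 : ‖w‖ ^ 2 = ∑ i, ‖u i‖ ^ 2 := by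
      rw [← stack_dotProduct_self, EuclideanSpace.norm_sq_eq]
      simp [hw, dotProduct, sq]
    rw [h1, ← h2]
    calc _ ≤ ‖w‖ * ‖toEuclideanCLM (𝕜 := ℝ) (S.AuAll + S.AuAllᵀ) w‖ := real_inner_le_norm _ _
      _ ≤ ‖w‖ * (a * ‖w‖) := by gcongr; exact ContinuousLinearMap.le_opNorm _ _
      _ = _ := by ring
  cases isEmpty_or_nonempty (Σ i, Fin (S.p i)) with
  | inl hempty =>
    -- all undetectable subspaces vanish; `lambdaMin` of the empty matrix is `sInf ∅ = 0`, and the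
    -- bound on `c` degenerates to `0 ≤ c`
    have hl : lambdaMin (S.UAllᵀ * S.laplacianKron * S.UAll) = 0 := by
      rw [lambdaMin, spectrum.of_subsingleton, Real.sInf_empty]
    rw [hl, div_zero] at hc
    refine ⟨hc, a, fun u => ⟨hA u, ?_⟩⟩
    rw [← stack_dotProduct_self]
    simp only [dotProduct, Finset.univ_eq_empty, Finset.sum_empty, mul_zero]
    exact mul_nonneg hc (S.coupling_self_nonneg _)
  | inr hne =>
    obtain ⟨hpos, hle⟩ := lambdaMin_pos_and_le (S.posDef_laplacian hconn hdet)
    have hc0 : 0 ≤ S.c := le_trans (by positivity) hc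
    refine ⟨hc0, a, fun u => ⟨hA u, ?_⟩⟩
    rw [← stack_dotProduct_laplacian, ← stack_dotProduct_self]
    rw [div_le_iff₀ hpos] at hc
    have h0 : 0 ≤ S.stack u ⬝ᵥ S.stack u := by rw [stack_dotProduct_self]; positivity
    calc _ ≤ S.c * lambdaMin (S.UAllᵀ * S.laplacianKron * S.UAll) * (S.stack u ⬝ᵥ S.stack u) := by
          gcongr
      _ ≤ _ := by rw [mul_assoc]; gcongr; exact hle _

end Design

open Filter Topology

/-! ### Sampling intervals and the triggering condition -/

lemma Reached.mono {ι : Type*} {ts : ι → ℕ → ℝ} {s t : ℝ} (ht : Reached ts t) (hs : 0 ≤ s)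
    (hst : s ≤ t) : Reached ts s :=
  ⟨hs, fun i => (ht.2 i).imp fun _ hk => hst.trans_lt hk⟩

namespace Design

variable {ι : Type*} [Fintype ι] {n : ℕ} {m : ι → ℕ} (S : Design ι n m)

lemma hold_eq (z : ℝ → E n) (s t : ℝ) : S.hold z s t = flow S.A (t - s) (z s) :=
  toEuclideanLin_exp _ _ _

lemma continuous_hold (z : ℝ → E n) (s : ℝ) : Continuous (S.hold z s) := by
  have h : S.hold z s = fun t => flow S.A (t - s) (z s) := funext (S.hold_eq z s)
  rw [h]
  exact ((continuous_flow S.A).comp (by fun_prop)).clm_apply continuous_const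

/-- The detectable coordinates of the plant flow follow the flow of `A_d`. -/
lemma dc_flow (i : ι) (v : E n) {t : ℝ} (ht : 0 ≤ t) :
    S.dc i (flow S.A t v) = flow (S.Ad i) t (S.dc i v) := by
  have hd : ∀ s, HasDerivAt (fun s => S.dc i (flow S.A s v))
      (toEuclideanLin (S.Ad i) (S.dc i (flow S.A s v))) s := by
    intro s
    rw [← dc_A]
    exact (S.dc i).hasFDerivAt.comp_hasDerivAt s (hasDerivAt_flow S.A v s)
  have h := eq_flow_of_deriv_right (S.Ad i) (a := 0) (b := t)
    (fun s _ => (hd s).continuousAt.continuousWithinAt)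
    (fun s _ => (hd s).hasDerivWithinAt) t ⟨ht, le_rfl⟩
  simpa using h

lemma norm_dc_le (i : ι) (v : E n) : ‖S.dc i v‖ ≤ ‖v‖ := by
  have h := S.norm_sq_eq i v
  exact (sq_le_sq₀ (norm_nonneg _) (norm_nonneg _)).1 (by nlinarith [sq_nonneg ‖S.uc i v‖])

lemma norm_uc_le (i : ι) (v : E n) : ‖S.uc i v‖ ≤ ‖v‖ := by
  have h := S.norm_sq_eq i v
  exact (sq_le_sq₀ (norm_nonneg _) (norm_nonneg _)).1 (by nlinarith [sq_nonneg ‖S.dc i v‖])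

variable [DecidableEq ι]

lemma sampleErr_eq (i : ι) (v : E n) :
    S.sampleErr i v = 4 * S.net.laplacian i i * ‖S.uc i v‖ ^ 2 := rfl

lemma continuous_sampleErr (i : ι) : Continuous (S.sampleErr i) := by
  have h : S.sampleErr i = fun v => 4 * S.net.laplacian i i * ‖S.uc i v‖ ^ 2 := rfl
  rw [h]
  fun_prop

end Design

namespace IsSolution

variable {ι : Type*} [Fintype ι] [DecidableEq ι] {n : ℕ} {m : ι → ℕ} {S : Design ι n m}
  {x : ℝ → E n} {xh xb : ι → ℝ → E n} {ρ : ι → ℝ → ℝ} {ts : ι → ℕ → ℝ} {w : ι → ι → ℝ → E n}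

lemma ts_nonneg (h : IsSolution S x xh xb ρ ts w) (i : ι) (k : ℕ) : 0 ≤ ts i k :=
  h.ts_zero i ▸ (h.ts_strictMono i).monotone (Nat.zero_le k)

lemma exists_index (h : IsSolution S x xh xb ρ ts w) {t : ℝ} (ht : Reached ts t) (i : ι) :
    ∃ k, ts i k ≤ t ∧ t < ts i (k + 1) := by
  classical
  have hf := Nat.find_spec (ht.2 i)
  have h0 : Nat.find (ht.2 i) ≠ 0 := by
    intro h0
    rw [h0, h.ts_zero] at hf
    exact absurd ht.1 (not_le.2 hf)
  obtain ⟨k, hk⟩ := Nat.exists_eq_succ_of_ne_zero h0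
  refine ⟨k, ?_, ?_⟩
  · exact not_lt.1 (Nat.find_min (ht.2 i) (by omega))
  · rwa [hk] at hf

lemma index_unique (h : IsSolution S x xh xb ρ ts w) {i : ι} {k k' : ℕ} {s : ℝ}
    (h1 : ts i k < s) (h2 : s < ts i (k + 1)) (h3 : ts i k' ≤ s) (h4 : s ≤ ts i (k' + 1)) :
    k' = k := by
  have h5 := (h.ts_strictMono i).lt_iff_lt.1 (h1.trans_le h4)
  have h6 := (h.ts_strictMono i).lt_iff_lt.1 (h3.trans_lt h2)
  omega

lemma mem_trigger (hadm : S.Admissible) (i : ι) (k : ℕ) :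
    ts i k + S.τ i ∈ {t | ts i k < t ∧
      (0 ≤ S.triggerFun i (S.hold (xh i) (ts i k) t) (xh i t) (fun j => w i j t) (ρ i t) ∨
        S.τ i ≤ t - ts i k)} :=
  ⟨by linarith [hadm.τ_pos i], Or.inr (by simp)⟩

lemma bddBelow_trigger (i : ι) (k : ℕ) :
    BddBelow {t | ts i k < t ∧
      (0 ≤ S.triggerFun i (S.hold (xh i) (ts i k) t) (xh i t) (fun j => w i j t) (ρ i t) ∨
        S.τ i ≤ t - ts i k)} :=
  ⟨ts i k, fun _ ht => ht.1.le⟩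

lemma ts_succ_le (h : IsSolution S x xh xb ρ ts w) (hadm : S.Admissible) (i : ι) (k : ℕ) :
    ts i (k + 1) ≤ ts i k + S.τ i := by
  rw [h.trigger i k]
  exact csInf_le (bddBelow_trigger i k) (mem_trigger hadm i k)

lemma triggerFun_neg (h : IsSolution S x xh xb ρ ts w) {i : ι} {k : ℕ} {t : ℝ}
    (h1 : ts i k < t) (h2 : t < ts i (k + 1)) :
    S.triggerFun i (S.hold (xh i) (ts i k) t) (xh i t) (fun j => w i j t) (ρ i t) < 0 := by
  rw [h.trigger i k] at h2
  by_contra hc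
  exact notMem_of_lt_csInf h2 (bddBelow_trigger i k) ⟨h1, Or.inl (not_lt.1 hc)⟩

lemma xh_tendsto (h : IsSolution S x xh xb ρ ts w) {t : ℝ} (ht : Reached ts t) (i : ι) :
    Tendsto (xh i) (𝓝[>] t) (𝓝 (xh i t)) :=
  ((h.xh_deriv i t ht).continuousWithinAt.mono Set.Ioi_subset_Ici_self).tendsto

lemma ρ_tendsto (h : IsSolution S x xh xb ρ ts w) {t : ℝ} (ht : Reached ts t) (i : ι) :
    Tendsto (ρ i) (𝓝[>] t) (𝓝 (ρ i t)) :=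
  ((h.ρ_deriv i t ht).continuousWithinAt.mono Set.Ioi_subset_Ici_self).tendsto

/-- Between samples the triggering function is negative. Passing to the limit from the right, where
no agent samples, gives the triggering inequality for the current predictions at all times,
sampling instants of the agent and of its neighbours included. -/
lemma sampleErr_le (h : IsSolution S x xh xb ρ ts w) {t : ℝ} (ht : Reached ts t) (i : ι) :
    S.sampleErr i (xb i t - xh i t)
      ≤ S.β * S.disagreement i (xb i t) (fun j => xb j t) + S.κ i * ρ i t := by
  choose k hk1 hk2 using h.exists_index ht
  have hxb : ∀ j, xb j t = S.hold (xh j) (ts j (k j)) t := fun j =>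
    h.prediction j (k j) t (hk1 j) (hk2 j)
  have hev : ∀ᶠ s in 𝓝[>] t, t < s ∧ ∀ j, s < ts j (k j + 1) := by
    refine eventually_mem_nhdsWithin.and (eventually_all.2 fun j => ?_)
    exact mem_nhdsWithin_of_mem_nhds (Iio_mem_nhds (hk2 j))
  have hneg : ∀ᶠ s in 𝓝[>] t, S.sampleErr i (S.hold (xh i) (ts i (k i)) s - xh i s)
      - S.β * S.disagreement i (S.hold (xh i) (ts i (k i)) s)
        (fun j => S.hold (xh j) (ts j (k j)) s) - S.κ i * ρ i s ≤ 0 := by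
    filter_upwards [hev] with s hs
    have hneg := h.triggerFun_neg ((hk1 i).trans_lt hs.1) (hs.2 i)
    have hr : Reached ts s := ⟨ht.1.trans hs.1.le, fun j => ⟨_, hs.2 j⟩⟩
    have hw : ∀ j, w i j s = S.hold (xh j) (ts j (k j)) s := by
      intro j
      obtain ⟨k', h1, h2, h3⟩ := h.neighbour i j s hr
      rw [h3, h.index_unique ((hk1 j).trans_lt hs.1) (hs.2 j) h1 h2]
    simp only [hw] at hneg
    exact hneg.le
  have hh : ∀ j, Tendsto (S.hold (xh j) (ts j (k j))) (𝓝[>] t)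
      (𝓝 (S.hold (xh j) (ts j (k j)) t)) := fun j =>
    ((S.continuous_hold _ _).tendsto t).mono_left nhdsWithin_le_nhds
  have hlim := le_of_tendsto
    (((((S.continuous_sampleErr i).tendsto _).comp ((hh i).sub (h.xh_tendsto ht i))).sub
      (Tendsto.const_mul S.β (tendsto_finsetSum Finset.univ fun j _ =>
        ((((hh i).sub (hh j)).norm.pow 2).const_mul (S.net.a i j))))).sub
      ((h.ρ_tendsto ht i).const_mul (S.κ i))) hneg
  simp only [hxb, Design.disagreement]
  linarith

/-- The auxiliary variables stay positive, with an explicit lower bound. -/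
lemma ρ_lower (h : IsSolution S x xh xb ρ ts w) (hadm : S.Admissible) {t : ℝ} (ht : Reached ts t)
    (i : ι) : ρ i 0 * Real.exp (-(S.δ i + S.κ i) * t) ≤ ρ i t := by
  set r := S.δ i + S.κ i with hr
  have hE : ∀ s, HasDerivAt (fun s => Real.exp (r * s)) (Real.exp (r * s) * r) s := fun s => by
    simpa using ((hasDerivAt_id s).const_mul r).exp
  have hre : ∀ s ∈ Set.Icc 0 t, Reached ts s := fun s hs => ht.mono hs.1 hs.2
  -- the triggering inequality gives `ρ' ≥ -(δ + κ) ρ`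
  have key := image_le_of_deriv_right_le_deriv_boundary (a := 0) (b := t)
    (f := fun s => -(ρ i s * Real.exp (r * s))) (B := fun _ => -ρ i 0) (B' := fun _ => 0)
    (f' := fun s => -(S.auxRhs i (x s) (xh i s) (fun j => xb j s) (ρ i s) * Real.exp (r * s)
      + ρ i s * (Real.exp (r * s) * r)))
    (((h.ρ_cont i).mono hre).mul (by fun_prop)).neg
    (fun s hs => ((h.ρ_deriv i s (hre s ⟨hs.1, hs.2.le⟩)).mul (hE s).hasDerivWithinAt).neg)
    (by simp) continuousOn_const (fun _ _ => hasDerivWithinAt_const _ _ _)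
    (fun s hs => by
      have h1 := h.sampleErr_le (hre s ⟨hs.1, hs.2.le⟩) i
      have h2 : 0 ≤ S.γ i * ‖toEuclideanLin (S.H i) (xh i s) - toEuclideanLin (S.H i) (x s)‖ ^ 2 :=
        mul_nonneg (hadm.γ_pos i).le (sq_nonneg _)
      have h3 : 0 ≤ S.auxRhs i (x s) (xh i s) (fun j => xb j s) (ρ i s) + r * ρ i s := by
        rw [Design.auxRhs, hr]; linarith
      have h4 := mul_nonneg h3 (Real.exp_pos (r * s)).le
      linarith)
    (Set.right_mem_Icc.2 ht.1)
  have h5 : ρ i 0 ≤ ρ i t * Real.exp (r * t) := by linarith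
  calc _ ≤ ρ i t * Real.exp (r * t) * Real.exp (-r * t) := by gcongr
    _ = ρ i t := by rw [mul_assoc, ← Real.exp_add]; simp

lemma ρ_pos (h : IsSolution S x xh xb ρ ts w) (hadm : S.Admissible) {t : ℝ} (ht : Reached ts t)
    (i : ι) : 0 < ρ i t :=
  (mul_pos (h.ρ_init i) (Real.exp_pos _)).trans_le (h.ρ_lower hadm ht i)

/-! ### Decay of the detectable part of the errors -/

lemma x_eq_flow (h : IsSolution S x xh xb ρ ts w) {s t : ℝ} (hs : 0 ≤ s) (hst : s ≤ t) :
    x t = flow S.A (t - s) (x s) :=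
  eq_flow_of_deriv_right S.A (a := s) (b := t)
    (fun r hr => ((h.plant r (hs.trans hr.1)).mono (Set.Icc_subset_Ici_self.trans
      (Set.Ici_subset_Ici.2 hs))).continuousWithinAt)
    (fun r hr => (h.plant r (hs.trans hr.1)).mono (Set.Ici_subset_Ici.2 (hs.trans hr.1)))
    t ⟨hst, le_rfl⟩

lemma x_cont (h : IsSolution S x xh xb ρ ts w) : ContinuousOn x {t | Reached ts t} :=
  fun t ht => (h.plant t ht.1).continuousWithinAt.mono fun _ hs => hs.1

/-- The prediction error started at a sample follows the plant flow. -/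
lemma prediction_sub (h : IsSolution S x xh xb ρ ts w) {i : ι} {k : ℕ} {t : ℝ}
    (h1 : ts i k ≤ t) (h2 : t < ts i (k + 1)) :
    xb i t - x t = flow S.A (t - ts i k) (xh i (ts i k) - x (ts i k)) := by
  rw [h.prediction i k t h1 h2, Design.hold_eq, h.x_eq_flow (h.ts_nonneg i k) h1, map_sub]

/-- The right derivative of the estimation error of an agent. -/
lemma err_deriv (h : IsSolution S x xh xb ρ ts w) {t : ℝ} (ht : Reached ts t) (i : ι) :
    HasDerivWithinAt (fun s => xh i s - x s)
      (toEuclideanLin S.A (xh i t - x t)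
        - S.dm i (toEuclideanLin (S.Ld i) (toEuclideanLin (S.Hd i) (S.dc i (xh i t - x t))))
        - S.c • S.um i (S.uc i (∑ j, S.net.a i j • (xb i t - xb j t)))) (Set.Ici t) t := by
  refine ((h.xh_deriv i t ht).sub
    ((h.plant t ht.1).mono (Set.Ici_subset_Ici.2 ht.1))).congr_deriv ?_
  rw [Design.observerRhs, Design.L_apply, Design.M_apply, ← Design.H_eq_Hd, ← map_sub,
    ← neg_sub (xh i t) (x t), map_neg, map_neg, map_neg, map_sub (toEuclideanLin S.A)]
  abel

/-- The detectable coordinates of the estimation error form an autonomous system. -/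
lemma dc_err_eq (h : IsSolution S x xh xb ρ ts w) {t : ℝ} (ht : Reached ts t) (i : ι) :
    S.dc i (xh i t - x t) = flow (S.Ad i - S.Ld i * S.Hd i) t (S.dc i (xh i 0 - x 0)) := by
  have hre : ∀ s ∈ Set.Icc 0 t, Reached ts s := fun s hs => ht.mono hs.1 hs.2
  have key := eq_flow_of_deriv_right (S.Ad i - S.Ld i * S.Hd i)
    (f := fun s => S.dc i (xh i s - x s)) (a := 0) (b := t)
    ((S.dc i).continuous.comp_continuousOn
      (((h.xh_cont i).mono hre).sub (h.x_cont.mono hre)))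
    (fun s hs => by
      have h1 := (S.dc i).hasFDerivAt.comp_hasDerivWithinAt s
        (h.err_deriv (hre s ⟨hs.1, hs.2.le⟩) i)
      refine h1.congr_deriv ?_
      rw [map_sub (S.dc i), map_sub (S.dc i), Design.dc_A, Design.dc_dm, map_smul,
        S.dc_eq_zero i (S.um_mem i _), smul_zero, sub_zero, map_sub toEuclideanLin,
        LinearMap.sub_apply,
        toEuclideanLin_mul_apply])
    t ⟨ht.1, le_rfl⟩
  simpa using key

end IsSolution

namespace Design

variable {ι : Type*} [Fintype ι] [DecidableEq ι] {n : ℕ} {m : ι → ℕ} (S : Design ι n m)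

/-- The detectable coordinates of the estimation error and of the prediction error of one agent
decay exponentially; for the latter because sampling intervals have bounded length. -/
lemma exists_dc_decay (hadm : S.Admissible) (i : ι) :
    ∃ K μ : ℝ, 0 < K ∧ 0 < μ ∧ ∀ (x : ℝ → E n) (xh xb : ι → ℝ → E n) (ρ : ι → ℝ → ℝ)
      (ts : ι → ℕ → ℝ) (w : ι → ι → ℝ → E n), IsSolution S x xh xb ρ ts w →
      ∀ t, Reached ts t →
        ‖S.dc i (xh i t - x t)‖ ≤ K * Real.exp (-μ * t) * ‖xh i 0 - x 0‖ ∧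
        ‖S.dc i (xb i t - x t)‖ ≤ K * Real.exp (-μ * t) * ‖xh i 0 - x 0‖ := by
  obtain ⟨K, μ, hK, hμ, hflow⟩ := (hadm.hurwitz i).exists_flow_le
  obtain ⟨B, hB⟩ := (isCompact_Icc (a := (0 : ℝ)) (b := S.τ i)).exists_bound_of_continuousOn
    (continuous_flow (S.Ad i)).continuousOn
  have hτ := hadm.τ_pos i
  have hB0 : 0 ≤ B := (norm_nonneg _).trans (hB 0 ⟨le_rfl, hτ.le⟩)
  refine ⟨K + B * K * Real.exp (μ * S.τ i), μ, by positivity, hμ,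
    fun x xh xb ρ ts w h t ht => ?_⟩
  have h1 : ∀ s, Reached ts s →
      ‖S.dc i (xh i s - x s)‖ ≤ K * Real.exp (-μ * s) * ‖xh i 0 - x 0‖ := by
    intro s hs
    rw [h.dc_err_eq hs i]
    exact (hflow s hs.1 _).trans (by gcongr; exact S.norm_dc_le i _)
  constructor
  · refine (h1 t ht).trans ?_
    gcongr
    linarith [show 0 ≤ B * K * Real.exp (μ * S.τ i) by positivity]
  · obtain ⟨k, hk1, hk2⟩ := h.exists_index ht i
    have hk0 := h.ts_nonneg i k
    have hlen := h.ts_succ_le hadm i k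
    rw [h.prediction_sub hk1 hk2, dc_flow S i _ (sub_nonneg.2 hk1)]
    calc _ ≤ ‖flow (S.Ad i) (t - ts i k)‖ * ‖S.dc i (xh i (ts i k) - x (ts i k))‖ :=
          ContinuousLinearMap.le_opNorm _ _
      _ ≤ B * (K * Real.exp (-μ * ts i k) * ‖xh i 0 - x 0‖) := by
          gcongr
          · exact hB _ ⟨by linarith, by linarith⟩
          · exact h1 _ (ht.mono hk0 hk1)
      _ ≤ B * (K * (Real.exp (μ * S.τ i) * Real.exp (-μ * t)) * ‖xh i 0 - x 0‖) := by
          rw [← Real.exp_add]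
          gcongr
          nlinarith
      _ = B * K * Real.exp (μ * S.τ i) * Real.exp (-μ * t) * ‖xh i 0 - x 0‖ := by ring
      _ ≤ _ := by gcongr; linarith

/-- The detectable parts of all errors together decay exponentially. -/
lemma exists_sum_dc_decay [Nonempty ι] (hadm : S.Admissible) :
    ∃ K μ : ℝ, 0 < K ∧ 0 < μ ∧ ∀ (x : ℝ → E n) (xh xb : ι → ℝ → E n) (ρ : ι → ℝ → ℝ)
      (ts : ι → ℕ → ℝ) (w : ι → ι → ℝ → E n), IsSolution S x xh xb ρ ts w →
      ∀ t, Reached ts t →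
        ∑ i, (‖S.dc i (xh i t - x t)‖ ^ 2 + ‖S.dc i (xb i t - x t)‖ ^ 2)
          ≤ K * Real.exp (-μ * t) * ∑ i, ‖xh i 0 - x 0‖ ^ 2 := by
  choose K μ hK hμ hdec using S.exists_dc_decay hadm
  obtain ⟨i₁, h₁⟩ := Finite.exists_max K
  obtain ⟨i₂, h₂⟩ := Finite.exists_min μ
  refine ⟨2 * K i₁ ^ 2, 2 * μ i₂, by have := hK i₁; positivity, by have := hμ i₂; positivity,
    fun x xh xb ρ ts w h t ht => ?_⟩
  rw [Finset.mul_sum]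
  refine Finset.sum_le_sum fun i _ => ?_
  obtain ⟨ha, hb⟩ := hdec i x xh xb ρ ts w h t ht
  have hle : K i * Real.exp (-μ i * t) * ‖xh i 0 - x 0‖
      ≤ K i₁ * Real.exp (-μ i₂ * t) * ‖xh i 0 - x 0‖ := by
    have := (hK i₁).le
    have := ht.1
    gcongr
    · exact h₁ i
    · exact h₂ i
  have ha' := pow_le_pow_left₀ (norm_nonneg _) (ha.trans hle) 2
  have hb' := pow_le_pow_left₀ (norm_nonneg _) (hb.trans hle) 2
  have hexp : Real.exp (-(2 * μ i₂) * t) = Real.exp (-μ i₂ * t) ^ 2 := by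
    rw [← Real.exp_nat_mul]; congr 1; push_cast; ring
  rw [hexp]
  calc _ ≤ _ := add_le_add ha' hb'
    _ = _ := by ring

end Design

/-! ### The Lyapunov inequality -/

/-- The pointwise estimate behind the Lyapunov inequality. Completing squares in
`ε = α + σ + θ` produces `-‖ε‖²`, which pays for the disagreement term of the auxiliary variables,
and `‖σ‖²`, which is paid for by their sampling error term. -/
lemma neg_two_inner_le {F : Type*} [NormedAddCommGroup F] [InnerProductSpace ℝ F] {β : ℝ}
    (h1 : β < 1) (α σ θ : F) :
    -2 * inner ℝ α (α + σ + θ) ≤ -(1 / 2) * ‖α‖ ^ 2 - β * ‖α + σ + θ‖ ^ 2 + ‖σ‖ ^ 2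
      + (2 + β / (1 - β)) * ‖θ‖ ^ 2 := by
  have hb : 0 < 1 - β := by linarith
  have e1 : -2 * inner ℝ α (α + σ) = -‖α‖ ^ 2 - ‖α + σ‖ ^ 2 + ‖σ‖ ^ 2 := by
    rw [inner_add_right, norm_add_sq_real, real_inner_self_eq_norm_sq]; ring
  have e2 : -2 * inner ℝ α θ ≤ 1 / 2 * ‖α‖ ^ 2 + 2 * ‖θ‖ ^ 2 := by
    have h := abs_le.1 (abs_real_inner_le_norm α θ)
    nlinarith [sq_nonneg (‖α‖ - 2 * ‖θ‖)]
  have e3 : β * ‖α + σ + θ‖ ^ 2 ≤ ‖α + σ‖ ^ 2 + β / (1 - β) * ‖θ‖ ^ 2 := by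
    have h : 0 ≤ ‖(1 - β) • (α + σ) - β • θ‖ ^ 2 := sq_nonneg _
    rw [norm_sub_sq_real, norm_smul, norm_smul, inner_smul_left, inner_smul_right, mul_pow, mul_pow,
      Real.norm_eq_abs, Real.norm_eq_abs, sq_abs, sq_abs] at h
    simp only [conj_trivial] at h
    rw [norm_add_sq_real (α + σ) θ]
    have h2 : 0 ≤ ((1 - β) ^ 2 * ‖α + σ‖ ^ 2
        - 2 * ((1 - β) * (β * inner ℝ (α + σ) θ)) + β ^ 2 * ‖θ‖ ^ 2) / (1 - β) :=
      div_nonneg h hb.le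
    have h3 : ((1 - β) ^ 2 * ‖α + σ‖ ^ 2
        - 2 * ((1 - β) * (β * inner ℝ (α + σ) θ)) + β ^ 2 * ‖θ‖ ^ 2) / (1 - β)
        = ‖α + σ‖ ^ 2 + β / (1 - β) * ‖θ‖ ^ 2
          - β * (‖α + σ‖ ^ 2 + 2 * inner ℝ (α + σ) θ + ‖θ‖ ^ 2) := by
      field_simp; ring
    linarith
  rw [inner_add_right]
  linarith

namespace Design

variable {ι : Type*} [Fintype ι] [DecidableEq ι] {n : ℕ} {m : ι → ℕ} (S : Design ι n m)

lemma coupling_self_le (v : ι → E n) :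
    S.coupling v v ≤ 2 * ∑ i, S.net.laplacian i i * ‖v i‖ ^ 2 := by
  have h1 : ∀ i j, S.net.a i j * inner ℝ (v i - v j) (v i - v j)
      ≤ 2 * (S.net.a i j * ‖v i‖ ^ 2) + 2 * (S.net.a i j * ‖v j‖ ^ 2) := by
    intro i j
    rw [real_inner_self_eq_norm_sq]
    have h2 : ‖v i - v j‖ ^ 2 ≤ 2 * ‖v i‖ ^ 2 + 2 * ‖v j‖ ^ 2 := by
      nlinarith [norm_sub_le (v i) (v j), norm_nonneg (v i - v j), sq_nonneg (‖v i‖ - ‖v j‖)]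
    nlinarith [mul_le_mul_of_nonneg_left h2 (S.weight_nonneg i j)]
  have h3 : ∑ i, ∑ j, S.net.a i j * ‖v i‖ ^ 2 = ∑ i, S.net.laplacian i i * ‖v i‖ ^ 2 := by
    simp only [laplacian_self, Finset.sum_mul]
  have h4 : ∑ i, ∑ j, S.net.a i j * ‖v j‖ ^ 2 = ∑ i, S.net.laplacian i i * ‖v i‖ ^ 2 := by
    rw [← h3, Finset.sum_comm]
    exact Finset.sum_congr rfl fun i _ => Finset.sum_congr rfl fun j _ => by rw [S.net.a_symm]
  rw [coupling_eq]
  calc _ ≤ 1 / 2 * ∑ i, ∑ j, (2 * (S.net.a i j * ‖v i‖ ^ 2) + 2 * (S.net.a i j * ‖v j‖ ^ 2)) := by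
        gcongr with i _ j _; exact h1 i j
    _ = _ := by
        simp only [Finset.sum_add_distrib, ← Finset.mul_sum]
        rw [h3, h4]; ring

/-- The consensus term, estimated through the errors `η` of the estimates and `e` of the
predictions. -/
lemma neg_two_coupling_le (hadm : S.Admissible) (η e : ι → E n) :
    -2 * S.coupling (fun i => S.um i (S.uc i (η i))) e
      ≤ -(1 / 2) * S.coupling (fun i => S.um i (S.uc i (η i))) (fun i => S.um i (S.uc i (η i)))
        - S.β / 2 * ∑ i, S.disagreement i (e i) e + 1 / 2 * ∑ i, S.sampleErr i (e i - η i)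
        + 2 * (2 + S.β / (1 - S.β)) * ∑ i, S.net.laplacian i i * ‖S.dc i (e i)‖ ^ 2 := by
  set v : ι → E n := fun i => S.um i (S.uc i (η i)) with hv
  set σ : ι → E n := fun i => S.um i (S.uc i (e i - η i)) with hσ
  set θ : ι → E n := fun i => S.dm i (S.dc i (e i)) with hθ
  have he : ∀ i, e i = v i + σ i + θ i := by
    intro i
    simp only [hv, hσ, hθ]
    rw [← map_add, ← map_add, add_sub_cancel, um_uc_add_dm_dc]
  have hpt : ∀ i j, -2 * (S.net.a i j * inner ℝ (v i - v j) (e i - e j))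
      ≤ -(1 / 2) * (S.net.a i j * inner ℝ (v i - v j) (v i - v j))
        - S.β * (S.net.a i j * inner ℝ (e i - e j) (e i - e j))
        + S.net.a i j * inner ℝ (σ i - σ j) (σ i - σ j)
        + (2 + S.β / (1 - S.β)) * (S.net.a i j * inner ℝ (θ i - θ j) (θ i - θ j)) := by
    intro i j
    have h := neg_two_inner_le hadm.β_lt_one (v i - v j) (σ i - σ j) (θ i - θ j)
    have hd : v i - v j + (σ i - σ j) + (θ i - θ j) = e i - e j := by
      rw [he i, he j]; abel
    rw [hd] at h
    simp only [← real_inner_self_eq_norm_sq] at h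
    have := mul_le_mul_of_nonneg_left h (S.weight_nonneg i j)
    linarith
  have hsum : -2 * S.coupling v e ≤ -(1 / 2) * S.coupling v v - S.β * S.coupling e e
      + S.coupling σ σ + (2 + S.β / (1 - S.β)) * S.coupling θ θ := by
    have h := Finset.sum_le_sum fun i (_ : i ∈ Finset.univ) =>
      Finset.sum_le_sum fun j (_ : j ∈ Finset.univ) => hpt i j
    simp only [Finset.sum_add_distrib, Finset.sum_sub_distrib, ← Finset.mul_sum] at h
    simp only [coupling_eq]
    linarith
  have hσ' : S.coupling σ σ ≤ 1 / 2 * ∑ i, S.sampleErr i (e i - η i) := by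
    refine (S.coupling_self_le σ).trans (le_of_eq ?_)
    simp only [sampleErr_eq, hσ, norm_um, Finset.mul_sum]
    exact Finset.sum_congr rfl fun i _ => by ring
  have hθ' : S.coupling θ θ ≤ 2 * ∑ i, S.net.laplacian i i * ‖S.dc i (e i)‖ ^ 2 := by
    refine (S.coupling_self_le θ).trans (le_of_eq ?_)
    simp only [hθ, norm_dm]
  have hK : 0 ≤ 2 + S.β / (1 - S.β) := by
    have := hadm.β_pos
    have : 0 < 1 - S.β := by linarith [hadm.β_lt_one]
    positivity
  have hθ'' := mul_le_mul_of_nonneg_left hθ' hK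
  have hee := S.coupling_self e
  rw [hee] at hsum
  linarith

/-- The derivative of the Lyapunov function `∑ ‖Uᵀ η‖² + (c / 2) ∑ ρ` along the closed loop,
bounded in terms of the detectable parts of the errors. The sampling error and the disagreement
cancel. -/
lemma exists_lyapunov_bound (hconn : S.net.graph.Connected) (hdet : Detectable S.A S.stackedH)
    (hadm : S.Admissible) :
    ∃ K : ℝ, 0 ≤ K ∧ ∀ (η e : ι → E n) (r : ι → ℝ),
      ∑ i, 2 * inner ℝ (S.uc i (η i)) (S.uc i (toEuclideanLin S.A (η i)
          - S.dm i (toEuclideanLin (S.Ld i) (toEuclideanLin (S.Hd i) (S.dc i (η i))))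
          - S.c • S.um i (S.uc i (∑ j, S.net.a i j • (e i - e j)))))
        + S.c / 2 * ∑ i, (-S.δ i * r i - S.sampleErr i (e i - η i)
          + S.β * S.disagreement i (e i) e + S.γ i * ‖toEuclideanLin (S.H i) (η i)‖ ^ 2)
      ≤ -∑ i, ‖S.uc i (η i)‖ ^ 2 - S.c / 2 * ∑ i, S.δ i * r i
        + K * ∑ i, (‖S.dc i (η i)‖ ^ 2 + ‖S.dc i (e i)‖ ^ 2) := by
  obtain ⟨hc, a, hcoer⟩ := S.exists_coercive hconn hdet hadm
  set α := ‖(toEuclideanLin S.A).toContinuousLinearMap‖ with hα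
  set g : ι → ℝ := fun i => ‖(toEuclideanLin (S.Hd i)).toContinuousLinearMap‖ with hg
  set k := 2 * (2 + S.β / (1 - S.β)) with hk
  have hk0 : 0 ≤ k := by
    have := hadm.β_pos
    have : 0 < 1 - S.β := by linarith [hadm.β_lt_one]
    positivity
  set Kf : ι → ℝ := fun i => α ^ 2 + S.c / 2 * (S.γ i * g i ^ 2) + S.c * (k * S.net.laplacian i i)
    with hKf
  have hKf0 : ∀ i, 0 ≤ Kf i := fun i => by
    have := (hadm.γ_pos i).le
    have := S.laplacian_self_nonneg i
    positivity
  refine ⟨∑ i, Kf i, Finset.sum_nonneg fun i _ => hKf0 i, fun η e r => ?_⟩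
  set u : ∀ i, E (S.p i) := fun i => S.uc i (η i) with hu
  obtain ⟨h1, h2⟩ := hcoer u
  have h3 := mul_le_mul_of_nonneg_left (S.neg_two_coupling_le hadm η e) hc
  have h4 : ∀ i, 2 * inner ℝ (u i) (S.uc i (toEuclideanLin S.A (η i)
          - S.dm i (toEuclideanLin (S.Ld i) (toEuclideanLin (S.Hd i) (S.dc i (η i))))
          - S.c • S.um i (S.uc i (∑ j, S.net.a i j • (e i - e j)))))
      ≤ 2 * inner ℝ (u i) (toEuclideanLin (S.Au i) (u i)) + ‖u i‖ ^ 2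
        + α ^ 2 * ‖S.dc i (η i)‖ ^ 2
        + S.c * (-2 * inner ℝ (S.um i (u i)) (∑ j, S.net.a i j • (e i - e j))) := by
    intro i
    have hA : S.uc i (toEuclideanLin S.A (η i)) = toEuclideanLin (S.Au i) (u i)
        + S.uc i (toEuclideanLin S.A (S.dm i (S.dc i (η i)))) := by
      conv_lhs => rw [← S.um_uc_add_dm_dc i (η i)]
      rw [map_add, map_add, uc_A_um]
    have hb : 2 * inner ℝ (u i) (S.uc i (toEuclideanLin S.A (S.dm i (S.dc i (η i)))))
        ≤ ‖u i‖ ^ 2 + α ^ 2 * ‖S.dc i (η i)‖ ^ 2 := by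
      have hn : ‖S.uc i (toEuclideanLin S.A (S.dm i (S.dc i (η i))))‖ ≤ α * ‖S.dc i (η i)‖ := by
        refine (S.norm_uc_le i _).trans ?_
        rw [← S.norm_dm i (S.dc i (η i))]
        exact ((toEuclideanLin S.A).toContinuousLinearMap).le_opNorm _
      have hi := (real_inner_le_norm (u i)
        (S.uc i (toEuclideanLin S.A (S.dm i (S.dc i (η i)))))).trans
        (mul_le_mul_of_nonneg_left hn (norm_nonneg _))
      nlinarith [sq_nonneg (‖u i‖ - α * ‖S.dc i (η i)‖)]
    rw [map_sub, map_sub, map_smul, uc_um, S.uc_eq_zero i (S.dm_mem i _), sub_zero, hA,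
      inner_sub_right, inner_add_right, inner_smul_right, inner_um]
    linarith
  have h5 := Finset.sum_le_sum fun i (_ : i ∈ Finset.univ) => h4 i
  have h6 : ∀ i, S.γ i * ‖toEuclideanLin (S.H i) (η i)‖ ^ 2
      ≤ S.γ i * g i ^ 2 * ‖S.dc i (η i)‖ ^ 2 := by
    intro i
    rw [H_eq_Hd, mul_assoc, ← mul_pow]
    have := (hadm.γ_pos i).le
    gcongr
    exact ((toEuclideanLin (S.Hd i)).toContinuousLinearMap).le_opNorm _
  have h7 := mul_le_mul_of_nonneg_left
    (Finset.sum_le_sum fun i (_ : i ∈ Finset.univ) => h6 i) (show 0 ≤ S.c * (1 / 2) by positivity)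
  have h8 : ∑ i, α ^ 2 * ‖S.dc i (η i)‖ ^ 2
      + S.c * (1 / 2) * ∑ i, S.γ i * g i ^ 2 * ‖S.dc i (η i)‖ ^ 2
      + S.c * (k * ∑ i, S.net.laplacian i i * ‖S.dc i (e i)‖ ^ 2)
      ≤ (∑ i, Kf i) * ∑ i, (‖S.dc i (η i)‖ ^ 2 + ‖S.dc i (e i)‖ ^ 2) := by
    rw [Finset.mul_sum Finset.univ (fun i => ‖S.dc i (η i)‖ ^ 2 + ‖S.dc i (e i)‖ ^ 2),
      Finset.mul_sum, Finset.mul_sum, Finset.mul_sum, ← Finset.sum_add_distrib,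
      ← Finset.sum_add_distrib]
    refine Finset.sum_le_sum fun i _ => ?_
    have hle : Kf i ≤ ∑ i, Kf i := Finset.single_le_sum (fun j _ => hKf0 j) (Finset.mem_univ i)
    refine le_trans ?_ (mul_le_mul_of_nonneg_right hle (by positivity))
    have hγ := (hadm.γ_pos i).le
    have hl := S.laplacian_self_nonneg i
    have p1 : 0 ≤ (α ^ 2 + S.c / 2 * (S.γ i * g i ^ 2)) * ‖S.dc i (e i)‖ ^ 2 := by positivity
    have p2 : 0 ≤ S.c * (k * S.net.laplacian i i) * ‖S.dc i (η i)‖ ^ 2 := by positivity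
    simp only [hKf]
    linarith
  have h9 : S.coupling (fun i => S.um i (u i)) e
      = ∑ i, inner ℝ (S.um i (u i)) (∑ j, S.net.a i j • (e i - e j)) := rfl
  simp only [Finset.sum_add_distrib, Finset.sum_sub_distrib, ← Finset.mul_sum, neg_mul,
    Finset.sum_neg_distrib] at h5 h7 h8 ⊢
  rw [← h9] at h5
  linarith

end Design

/-! ### Exponential decay of the errors -/

namespace Design

variable {ι : Type*} [Fintype ι] [DecidableEq ι] {n : ℕ} {m : ι → ℕ} (S : Design ι n m)

/-- Exponential decay of the estimation errors for as long as no sampling sequence accumulates. -/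
lemma exists_exp_decay (hconn : S.net.graph.Connected) (hdet : Detectable S.A S.stackedH)
    (hadm : S.Admissible) :
    ∃ ξ : ℝ, 0 < ξ ∧ ∃ C : ℝ, 0 < C ∧ ∀ (x : ℝ → E n) (xh xb : ι → ℝ → E n) (ρ : ι → ℝ → ℝ)
      (ts : ι → ℕ → ℝ) (w : ι → ι → ℝ → E n), IsSolution S x xh xb ρ ts w →
      ∀ i t, Reached ts t → ‖xh i t - x t‖
        ≤ C * Real.sqrt (∑ j, (‖xh j 0 - x 0‖ ^ 2 + ρ j 0)) * Real.exp (-ξ * t) := by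
  have := hconn.nonempty
  obtain ⟨K', μ, hK', hμ, hdec⟩ := S.exists_sum_dc_decay hadm
  obtain ⟨K, hK, hlyap⟩ := S.exists_lyapunov_bound hconn hdet hadm
  obtain ⟨hc, -⟩ := S.exists_coercive hconn hdet hadm
  obtain ⟨i₀, hi₀⟩ := Finite.exists_min S.δ
  obtain ⟨ω, hω, hω1, hωδ, hωμ⟩ : ∃ ω : ℝ, 0 < ω ∧ ω ≤ 1 ∧ (∀ i, ω ≤ S.δ i) ∧ ω ≤ μ / 2 :=
    ⟨min (min 1 (S.δ i₀)) (μ / 2), lt_min (lt_min one_pos (hadm.δ_pos i₀)) (half_pos hμ),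
      (min_le_left _ _).trans (min_le_left _ _),
      fun i => ((min_le_left _ _).trans (min_le_right _ _)).trans (hi₀ i), min_le_right _ _⟩
  set Ct : ℝ := 1 + S.c / 2 + K * K' / ω + K' with hCt
  have hCt0 : 0 < Ct := by positivity
  refine ⟨ω / 2, by positivity, Real.sqrt Ct, Real.sqrt_pos.2 hCt0,
    fun x xh xb ρ ts w h i t ht => ?_⟩
  set S₀ := ∑ j, ‖xh j 0 - x 0‖ ^ 2 with hS₀
  have hS₀0 : 0 ≤ S₀ := Finset.sum_nonneg fun _ _ => sq_nonneg _
  have hρ0 : 0 ≤ ∑ j, ρ j 0 := Finset.sum_nonneg fun j _ => (h.ρ_init j).le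
  set V : ℝ → ℝ := fun s => ∑ j, ‖S.uc j (xh j s - x s)‖ ^ 2 + S.c / 2 * ∑ j, ρ j s with hV
  have hre : ∀ s ∈ Set.Icc 0 t, Reached ts s := fun s hs => ht.mono hs.1 hs.2
  have hVc : ContinuousOn V (Set.Icc 0 t) := by
    refine (continuousOn_finsetSum _ fun j _ => ?_).add
      (continuousOn_const.mul (continuousOn_finsetSum _ fun j _ => (h.ρ_cont j).mono hre))
    exact (((S.uc j).continuous.comp_continuousOn
      (((h.xh_cont j).mono hre).sub (h.x_cont.mono hre))).norm).pow 2
  have hVd : ∀ s ∈ Set.Ico 0 t, ∃ V' : ℝ, HasDerivWithinAt V V' (Set.Ici s) s ∧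
      V' ≤ -ω * V s + K * K' * S₀ * Real.exp (-μ * s) := by
    intro s hs
    have hr := hre s ⟨hs.1, hs.2.le⟩
    have hb := hlyap (fun j => xh j s - x s) (fun j => xb j s - x s) (fun j => ρ j s)
    have hD := hdec x xh xb ρ ts w h s hr
    refine ⟨_, (HasDerivWithinAt.fun_sum fun j _ =>
      (((S.uc j).hasFDerivAt.comp_hasDerivWithinAt s (h.err_deriv hr j)).norm_sq)).add
      ((HasDerivWithinAt.fun_sum fun j _ => h.ρ_deriv j s hr).const_mul (S.c / 2)), ?_⟩
    have hrew : ∀ j, S.auxRhs j (x s) (xh j s) (fun j => xb j s) (ρ j s)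
        = -S.δ j * ρ j s - S.sampleErr j (xb j s - x s - (xh j s - x s))
          + S.β * S.disagreement j (xb j s - x s) (fun j => xb j s - x s)
          + S.γ j * ‖toEuclideanLin (S.H j) (xh j s - x s)‖ ^ 2 := by
      intro j
      simp only [auxRhs, disagreement, sub_sub_sub_cancel_right, map_sub]
    simp only [sub_sub_sub_cancel_right] at hb
    simp only [hrew, sub_sub_sub_cancel_right]
    refine hb.trans ?_
    have hW : ω * ∑ j, ‖S.uc j (xh j s - x s)‖ ^ 2 ≤ ∑ j, ‖S.uc j (xh j s - x s)‖ ^ 2 :=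
      mul_le_of_le_one_left (Finset.sum_nonneg fun _ _ => sq_nonneg _) hω1
    have hδ : ω * ∑ j, ρ j s ≤ ∑ j, S.δ j * ρ j s := by
      rw [Finset.mul_sum]
      exact Finset.sum_le_sum fun j _ =>
        mul_le_mul_of_nonneg_right (hωδ j) (h.ρ_pos hadm hr j).le
    have hδ' := mul_le_mul_of_nonneg_left hδ (show 0 ≤ S.c / 2 by positivity)
    have hD' := mul_le_mul_of_nonneg_left hD hK
    simp only [hV]
    linarith
  choose! V' hV1 hV2 using hVd
  have hE : ∀ (r s : ℝ), HasDerivAt (fun s => Real.exp (r * s)) (Real.exp (r * s) * r) s :=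
    fun r s => by simpa using ((hasDerivAt_id s).const_mul r).exp
  -- compare `V s * exp (ω s)` with the integral of the decaying terms
  have key := image_le_of_deriv_right_le_deriv_boundary (a := 0) (b := t)
    (f := fun s => V s * Real.exp (ω * s))
    (B := fun s => V 0 + K * K' * S₀ / ω * (1 - Real.exp (-ω * s)))
    (B' := fun s => K * K' * S₀ / ω * (-(Real.exp (-ω * s) * -ω)))
    (f' := fun s => V' s * Real.exp (ω * s) + V s * (Real.exp (ω * s) * ω))
    (hVc.mul (by fun_prop))
    (fun s hs => (hV1 s hs).mul (hE ω s).hasDerivWithinAt)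
    (by simp) (by fun_prop)
    (fun s _ => ((((hE (-ω) s).const_sub 1).const_mul _).const_add _).hasDerivWithinAt)
    (fun s hs => by
      have h1 := mul_le_mul_of_nonneg_right (hV2 s hs) (Real.exp_pos (ω * s)).le
      have h2 : Real.exp (-μ * s) * Real.exp (ω * s) ≤ Real.exp (-ω * s) := by
        rw [← Real.exp_add]
        exact Real.exp_le_exp.2 (by nlinarith [hs.1])
      have h3 := mul_le_mul_of_nonneg_left h2 (show 0 ≤ K * K' * S₀ by positivity)
      have h4 : K * K' * S₀ / ω * (-(Real.exp (-ω * s) * -ω))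
          = K * K' * S₀ * Real.exp (-ω * s) := by field_simp
      rw [h4]
      linarith)
    (Set.right_mem_Icc.2 ht.1)
  have hVt : V t ≤ (V 0 + K * K' * S₀ / ω) * Real.exp (-ω * t) := by
    have h1 : V t * Real.exp (ω * t) ≤ V 0 + K * K' * S₀ / ω := by
      refine key.trans ?_
      have : 0 ≤ K * K' * S₀ / ω * Real.exp (-ω * t) := by positivity
      linarith
    calc V t = V t * Real.exp (ω * t) * Real.exp (-ω * t) := by
          rw [mul_assoc, ← Real.exp_add]; simp
      _ ≤ _ := by gcongr
  have hV0 : V 0 ≤ S₀ + S.c / 2 * ∑ j, ρ j 0 := by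
    simp only [hV, hS₀]
    gcongr with j
    exact S.norm_uc_le j _
  have hdt : ∑ j, ‖S.dc j (xh j t - x t)‖ ^ 2 ≤ K' * Real.exp (-ω * t) * S₀ := by
    refine le_trans ?_ ((hdec x xh xb ρ ts w h t ht).trans ?_)
    · exact Finset.sum_le_sum fun j _ => le_add_of_nonneg_right (sq_nonneg _)
    · have := ht.1
      gcongr
      linarith
  have hWt : ∑ j, ‖S.uc j (xh j t - x t)‖ ^ 2 ≤ V t := by
    refine le_add_of_nonneg_right (mul_nonneg (by positivity) (Finset.sum_nonneg fun j _ => ?_))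
    exact (h.ρ_pos hadm ht j).le
  have hsq : ‖xh i t - x t‖ ^ 2 ≤ Ct * (S₀ + ∑ j, ρ j 0) * Real.exp (-ω * t) := by
    calc ‖xh i t - x t‖ ^ 2 ≤ ∑ j, ‖xh j t - x t‖ ^ 2 :=
          Finset.single_le_sum (f := fun j => ‖xh j t - x t‖ ^ 2) (fun _ _ => sq_nonneg _)
            (Finset.mem_univ i)
      _ = ∑ j, ‖S.uc j (xh j t - x t)‖ ^ 2 + ∑ j, ‖S.dc j (xh j t - x t)‖ ^ 2 := by
          rw [← Finset.sum_add_distrib]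
          exact Finset.sum_congr rfl fun j _ => S.norm_sq_eq j _
      _ ≤ (V 0 + K * K' * S₀ / ω) * Real.exp (-ω * t) + K' * Real.exp (-ω * t) * S₀ := by
          linarith
      _ = (V 0 + K * K' / ω * S₀ + K' * S₀) * Real.exp (-ω * t) := by ring
      _ ≤ _ := by
          gcongr
          have p1 : 0 ≤ (1 + K * K' / ω + K') * ∑ j, ρ j 0 := by positivity
          have p2 : 0 ≤ S.c / 2 * S₀ := by positivity
          rw [hCt]
          linarith
  have hexp : Real.exp (-ω * t) = Real.exp (-(ω / 2) * t) ^ 2 := by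
    rw [← Real.exp_nat_mul]; congr 1; push_cast; ring
  rw [Finset.sum_add_distrib, ← hS₀]
  refine (sq_le_sq₀ (norm_nonneg _) (by positivity)).1 ?_
  rw [mul_pow, mul_pow, Real.sq_sqrt hCt0.le, Real.sq_sqrt (by positivity), ← hexp]
  exact hsq

end Design

/-! ### Absence of accumulation of sampling instants -/

namespace IsSolution

variable {ι : Type*} [Fintype ι] [DecidableEq ι] {n : ℕ} {m : ι → ℕ} {S : Design ι n m}
  {x : ℝ → E n} {xh xb : ι → ℝ → E n} {ρ : ι → ℝ → ℝ} {ts : ι → ℕ → ℝ} {w : ι → ι → ℝ → E n}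

/-- If a sampling interval is shorter than the maximal length, then the sampling error at its end
is at least `κ ρ`: the instant is a limit from the right of times at which the triggering function
is nonnegative. -/
lemma le_sampleErr_of_lt (h : IsSolution S x xh xb ρ ts w) (hadm : S.Admissible) {i : ι} {k : ℕ}
    (hr : Reached ts (ts i (k + 1))) (hlt : ts i (k + 1) - ts i k < S.τ i) :
    S.κ i * ρ i (ts i (k + 1))
      ≤ S.sampleErr i (S.hold (xh i) (ts i k) (ts i (k + 1)) - xh i (ts i (k + 1))) := by
  set a := ts i (k + 1) with ha
  set A := {t | ts i k < t ∧
      (0 ≤ S.triggerFun i (S.hold (xh i) (ts i k) t) (xh i t) (fun j => w i j t) (ρ i t) ∨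
        S.τ i ≤ t - ts i k)} with hA
  have haA : a = sInf A := h.trigger i k
  have hbdd : BddBelow A := bddBelow_trigger i k
  have hfreq : ∃ᶠ t in 𝓝 a, t ∈ A := by
    rw [← mem_closure_iff_frequently, haA]
    exact csInf_mem_closure ⟨_, mem_trigger hadm i k⟩ hbdd
  have hfreq' : ∃ᶠ t in 𝓝[≥] a, 0 ≤
      S.sampleErr i (S.hold (xh i) (ts i k) t - xh i t) - S.κ i * ρ i t := by
    rw [frequently_nhdsWithin_iff]
    refine (hfreq.and_eventually (Iio_mem_nhds (show a < ts i k + S.τ i by linarith))).mono ?_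
    rintro t ⟨htA, htlt⟩
    refine ⟨?_, ?_⟩
    · rcases htA.2 with h1 | h1
      · have h2 := mul_nonneg hadm.β_pos.le (S.disagreement_nonneg i
          (S.hold (xh i) (ts i k) t) (fun j => w i j t))
        rw [Design.triggerFun] at h1
        linarith
      · have : t < ts i k + S.τ i := htlt
        linarith
    · change a ≤ t
      rw [haA]
      exact csInf_le hbdd htA
  have hlim : Tendsto (fun t => S.sampleErr i (S.hold (xh i) (ts i k) t - xh i t) - S.κ i * ρ i t)
      (𝓝[≥] a) (𝓝 (S.sampleErr i (S.hold (xh i) (ts i k) a - xh i a) - S.κ i * ρ i a)) :=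
    ((((S.continuous_sampleErr i).tendsto _).comp
      ((((S.continuous_hold _ _).tendsto a).mono_left nhdsWithin_le_nhds).sub
        (h.xh_deriv i a hr).continuousWithinAt.tendsto))).sub
      ((h.ρ_deriv i a hr).continuousWithinAt.tendsto.const_mul (S.κ i))
  exact sub_nonneg.1 (ge_of_tendsto_of_frequently hlim hfreq')

/-- If the estimates stay bounded on `[0, T)`, then so do the predictions, which start at samples of
the estimates, and the estimates are Lipschitz continuous there. -/
lemma exists_lipschitz (h : IsSolution S x xh xb ρ ts w) {T R : ℝ}
    (hT : ∀ t, 0 ≤ t → t < T → Reached ts t)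
    (hR : ∀ t, 0 ≤ t → t < T → ∀ i, ‖xh i t‖ ≤ R) (i : ι) :
    ∃ Λ, ∀ s t, 0 ≤ s → s ≤ t → t < T → ‖xh i t - xh i s‖ ≤ Λ * (t - s) := by
  obtain ⟨Rx, hRx⟩ := (isCompact_Icc (a := (0 : ℝ)) (b := T)).exists_bound_of_continuousOn
    (f := x) (fun t ht => ((h.plant t ht.1).mono Set.Icc_subset_Ici_self).continuousWithinAt)
  obtain ⟨Bf, hBf⟩ := (isCompact_Icc (a := (0 : ℝ)) (b := T)).exists_bound_of_continuousOn
    (continuous_flow S.A).continuousOn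
  set Q := max Rx (max R (max (Bf * R) 0)) with hQ
  have hcont : Continuous fun p : E n × E n × (ι → E n) => S.observerRhs i p.1 p.2.1 p.2.2 := by
    have hl : ∀ {a b : ℕ} (X : Matrix (Fin a) (Fin b) ℝ), Continuous (toEuclideanLin X) :=
      fun X => (toEuclideanLin X).continuous_of_finiteDimensional
    have h1 := hl S.A
    have h2 := hl (S.L i)
    have h3 := hl (S.H i)
    have h4 := hl (S.M i)
    unfold Design.observerRhs
    fun_prop
  obtain ⟨Λ, hΛ⟩ := (isCompact_closedBall (0 : E n × E n × (ι → E n)) Q).exists_bound_of_continuousOn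
    hcont.continuousOn
  refine ⟨Λ, fun s t hs hst htT => ?_⟩
  refine norm_image_sub_le_of_norm_deriv_right_le_segment (a := s) (b := t)
    (f := xh i) ((h.xh_cont i).mono fun r hr => hT r (hs.trans hr.1) (hr.2.trans_lt htT))
    (fun r hr => h.xh_deriv i r (hT r (hs.trans hr.1) (hr.2.trans htT)))
    (fun r hr => ?_) t ⟨hst, le_rfl⟩
  have hr0 : 0 ≤ r := hs.trans hr.1
  have hrT : r < T := hr.2.trans htT
  refine hΛ (x r, xh i r, fun j => xb j r) ?_
  rw [mem_closedBall_zero_iff]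
  refine max_le ((hRx r ⟨hr0, hrT.le⟩).trans (le_max_left _ _)) (max_le ?_ ?_)
  · exact (hR r hr0 hrT i).trans ((le_max_left _ _).trans (le_max_right _ _))
  · refine (pi_norm_le_iff_of_nonneg (by positivity)).2 fun j => ?_
    obtain ⟨k, hk1, hk2⟩ := h.exists_index (hT r hr0 hrT) j
    have hk0 := h.ts_nonneg j k
    have hxb : ‖xb j r‖ ≤ Bf * R := by
      rw [h.prediction j k r hk1 hk2, Design.hold_eq]
      have hb := hBf (r - ts j k) ⟨by linarith, by linarith⟩
      exact (ContinuousLinearMap.le_opNorm _ _).trans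
        (mul_le_mul hb (hR _ hk0 (hk1.trans_lt hrT) j) (norm_nonneg _)
          ((norm_nonneg _).trans hb))
    exact hxb.trans ((le_max_left _ _).trans ((le_max_right _ _).trans (le_max_right _ _)))

/-- No sampling sequence accumulates if the errors stay bounded. At the first accumulation time the
sampling errors would tend to zero by Lipschitz continuity, while the auxiliary variable of the
agent stays bounded away from zero there. -/
lemma tendsto_ts (h : IsSolution S x xh xb ρ ts w) (hadm : S.Admissible) {R : ℝ}
    (hR : ∀ i t, Reached ts t → ‖xh i t - x t‖ ≤ R) (i : ι) : Tendsto (ts i) atTop atTop := by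
  by_contra hnot
  have hdich : ∀ j, Tendsto (ts j) atTop atTop ∨ ∃ l, Tendsto (ts j) atTop (𝓝 l) := fun j =>
    tendsto_atTop_of_monotone (h.ts_strictMono j).monotone
  choose! l hl using fun j (hj : ¬ Tendsto (ts j) atTop atTop) => (hdich j).resolve_left hj
  classical
  -- the agent whose sampling instants accumulate first
  obtain ⟨a, ha, hmin⟩ := (Finset.univ.filter fun j => ¬ Tendsto (ts j) atTop atTop).exists_min_image
    l ⟨i, by simpa using hnot⟩
  simp only [Finset.mem_filter, Finset.mem_univ, true_and] at ha hmin
  set T := l a with hTdef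
  have hta : Tendsto (ts a) atTop (𝓝 T) := hl a ha
  have hltT : ∀ k, ts a k < T := fun k =>
    ((h.ts_strictMono a) (Nat.lt_succ_self k)).trans_le
      ((h.ts_strictMono a).monotone.ge_of_tendsto hta (k + 1))
  have hT0 : 0 < T := h.ts_zero a ▸ hltT 0
  have hT : ∀ t, 0 ≤ t → t < T → Reached ts t := by
    refine fun t ht htT => ⟨ht, fun j => ?_⟩
    by_cases hj : Tendsto (ts j) atTop atTop
    · exact (hj.eventually_gt_atTop t).exists
    · exact ((hl j hj).eventually_const_lt (htT.trans_le (hmin j hj))).exists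
  obtain ⟨Rx, hRx⟩ := (isCompact_Icc (a := (0 : ℝ)) (b := T)).exists_bound_of_continuousOn
    (f := x) (fun t ht => ((h.plant t ht.1).mono Set.Icc_subset_Ici_self).continuousWithinAt)
  have hxh : ∀ t, 0 ≤ t → t < T → ∀ j, ‖xh j t‖ ≤ R + Rx := by
    intro t ht htT j
    have h1 := hR j t (hT t ht htT)
    have h2 := hRx t ⟨ht, htT.le⟩
    have h3 := norm_add_le (xh j t - x t) (x t)
    rw [sub_add_cancel] at h3
    linarith
  obtain ⟨Λ, hΛ⟩ := h.exists_lipschitz hT hxh a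
  have hts1 : Tendsto (fun k => ts a (k + 1)) atTop (𝓝 T) := hta.comp (tendsto_add_atTop_nat 1)
  have hgap : Tendsto (fun k => ts a (k + 1) - ts a k) atTop (𝓝 0) := by
    simpa using hts1.sub hta
  -- the prediction error at the end of the sampling intervals tends to zero
  have hz : Tendsto (fun k => S.hold (xh a) (ts a k) (ts a (k + 1)) - xh a (ts a (k + 1)))
      atTop (𝓝 0) := by
    have hflow : Tendsto (fun k => ‖flow S.A (ts a (k + 1) - ts a k) - flow S.A 0‖ * (R + Rx)
        + Λ * (ts a (k + 1) - ts a k)) atTop (𝓝 0) := by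
      have h1 := ((((continuous_flow S.A).tendsto 0).comp hgap).sub_const (flow S.A 0)).norm
      simpa using (h1.mul_const (R + Rx)).add (hgap.const_mul Λ)
    refine squeeze_zero_norm (fun k => ?_) hflow
    have hk0 := h.ts_nonneg a k
    have hkk := (h.ts_strictMono a) (Nat.lt_succ_self k)
    have h1 := hΛ (ts a k) (ts a (k + 1)) hk0 hkk.le (hltT _)
    have h2 : ‖(flow S.A (ts a (k + 1) - ts a k) - flow S.A 0) (xh a (ts a k))‖
        ≤ ‖flow S.A (ts a (k + 1) - ts a k) - flow S.A 0‖ * (R + Rx) :=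
      (ContinuousLinearMap.le_opNorm _ _).trans
        (mul_le_mul_of_nonneg_left (hxh _ hk0 (hltT k) a) (norm_nonneg _))
    have h3 : S.hold (xh a) (ts a k) (ts a (k + 1)) - xh a (ts a (k + 1))
        = (flow S.A (ts a (k + 1) - ts a k) - flow S.A 0) (xh a (ts a k))
          - (xh a (ts a (k + 1)) - xh a (ts a k)) := by
      rw [Design.hold_eq, _root_.sub_apply, flow_zero]
      abel
    rw [h3]
    exact (norm_sub_le _ _).trans (add_le_add h2 h1)
  have hs := ((S.continuous_sampleErr a).tendsto 0).comp hz
  have hs0 : S.sampleErr a 0 = 0 := by simp [Design.sampleErr]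
  rw [hs0] at hs
  set b := S.κ a * (ρ a 0 * Real.exp (-(S.δ a + S.κ a) * T)) with hb
  have hb0 : 0 < b := mul_pos (hadm.κ_pos a) (mul_pos (h.ρ_init a) (Real.exp_pos _))
  obtain ⟨k, hk1, hk2⟩ := ((hs.eventually_lt_const hb0).and
    (hgap.eventually_lt_const (hadm.τ_pos a))).exists
  have hr : Reached ts (ts a (k + 1)) := hT _ (h.ts_nonneg a _) (hltT _)
  have h1 := h.le_sampleErr_of_lt hadm hr hk2
  have h2 := h.ρ_lower hadm hr a
  have h3 : b ≤ S.κ a * ρ a (ts a (k + 1)) := by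
    refine mul_le_mul_of_nonneg_left (le_trans ?_ h2) (hadm.κ_pos a).le
    have := (h.ρ_init a).le
    have := hadm.δ_pos a
    have := hadm.κ_pos a
    have := hltT (k + 1)
    refine mul_le_mul_of_nonneg_left (Real.exp_le_exp.2 ?_) (h.ρ_init a).le
    nlinarith
  simp only [Function.comp_apply] at hk1
  linarith

end IsSolution

end DistributedObserver

end

theorem theorem3p1 {ι : Type*} [Fintype ι] [DecidableEq ι] {n : ℕ} {m : ι → ℕ}
    (S : DistributedObserver.Design ι n m)
    (hconn : S.net.graph.Connected)
    (hdet : DistributedObserver.Detectable S.A S.stackedH)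
    (hadm : S.Admissible) :
    ∃ ξ : ℝ, 0 < ξ ∧ ∃ C : ℝ, 0 < C ∧
      ∀ (x : ℝ → DistributedObserver.E n) (xh xb : ι → ℝ → DistributedObserver.E n)
        (ρ : ι → ℝ → ℝ) (ts : ι → ℕ → ℝ) (w : ι → ι → ℝ → DistributedObserver.E n),
        DistributedObserver.IsSolution S x xh xb ρ ts w →
        (∀ i, Filter.Tendsto (ts i) Filter.atTop Filter.atTop) ∧
        ∀ i t, 0 ≤ t →
          ‖xh i t - x t‖ ≤
            C * Real.sqrt (∑ j, (‖xh j 0 - x 0‖ ^ 2 + ρ j 0)) * Real.exp (-ξ * t) := by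
  obtain ⟨ξ, hξ, C, hC, hdecay⟩ := S.exists_exp_decay hconn hdet hadm
  refine ⟨ξ, hξ, C, hC, fun x xh xb ρ ts w h => ?_⟩
  have hts : ∀ i, Filter.Tendsto (ts i) Filter.atTop Filter.atTop := fun i =>
    h.tendsto_ts hadm (R := C * Real.sqrt (∑ j, (‖xh j 0 - x 0‖ ^ 2 + ρ j 0))) (fun j t ht =>
      (hdecay x xh xb ρ ts w h j t ht).trans (mul_le_of_le_one_right (by positivity)
        (Real.exp_le_one_iff.2 (by nlinarith [ht.1])))) i
  exact ⟨hts, fun i t ht => hdecay x xh xb ρ ts w h i t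
    ⟨ht, fun j => ((hts j).eventually_gt_atTop t).exists⟩⟩
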